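/- Let $n\ge 1$, $s>1/2$, and let $a(\xi)=a(\xi_1,\dots,\xi_n)$ be a polynomial on $\mathbb R^n$ with real coefficients. Write $\langle x\rangle=(1+|x|^2)^{1/2}$ and $D_x=-i\nabla_x$, and for functions $\sigma$ of polynomial growth let $\sigma(D_x)$ be the Fourier multiplier with symbol $\sigma(\xi)$. Then there is a constant $C>0$, depending only on $n$, $s$ and $a$, such that for every $\varphi\in L^2(\mathbb R^n)$ the tempered distribution $|\nabla a(D_x)|^{1/2}e^{ita(D_x)}\varphi$ is, for almost every $t\in\mathbb R$, given by a function of $x$, and this function can be chosen measurable in $(t,x)$ and satisfies $$\bigl\|\langle x\rangle^{-s}\,|\nabla a(D_x)|^{1/2}e^{ita(D_x)}\varphi(x)\bigr\|_{L^2(\mathbb R_t\times\mathbb R^n_x)}\le C\,\|\varphi\|_{L^2(\mathbb R^n_x)} .$$ -/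

import Mathlib

open MeasureTheory
open scoped FourierTransform SchwartzMap

noncomputable section

/-- The space `ℝⁿ` with its Euclidean norm. -/
abbrev RSpace (n : ℕ) : Type := EuclideanSpace ℝ (Fin n)

/-- The Japanese bracket `⟨x⟩ = (1 + |x|²)^{1/2}`. -/
def japaneseBracket {n : ℕ} (x : RSpace n) : ℝ := Real.sqrt (1 + ‖x‖ ^ 2)

/-- The function `ξ ↦ a(ξ)` on `ℝⁿ` given by a real polynomial `a` in `n` variables. -/
def polySymbol {n : ℕ} (a : MvPolynomial (Fin n) ℝ) (ξ : RSpace n) : ℝ :=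
  MvPolynomial.eval (fun j => ξ j) a

/-- `IsFourierMultiplier σ φ u` says that the function `u` is `σ(D)φ`, where `D = -i∇`, `φ ∈ L²(ℝⁿ)`
and `σ` is a symbol of polynomial growth. In general `σ(D)φ` is only a tempered distribution:
it is the inverse Fourier transform of `σ φ̂`. With the normalization
`φ̂(ξ) = ∫ e^{-2πi x·ξ} φ(x) dx` used by Mathlib, `D` has the symbol `2πξ`, so
`⟨σ(D)φ, ψ⟩ = ∫ σ(2πξ) φ̂(ξ) (𝓕⁻¹ψ)(ξ) dξ` for every Schwartz function `ψ`. The predicate says that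
this distribution is the one given by integration against `u`; this determines `u` up to
null sets. Both integrals are required to converge absolutely. -/
def IsFourierMultiplier {n : ℕ} (σ : RSpace n → ℂ)
    (φ : Lp ℂ 2 (volume : Measure (RSpace n))) (u : RSpace n → ℂ) : Prop :=
  ∀ ψ : 𝓢(RSpace n, ℂ),
    Integrable (fun x => u x * ψ x) ∧
    Integrable (fun ξ => σ ((2 * Real.pi) • ξ) * (𝓕 φ) ξ * (𝓕⁻ ψ) ξ) ∧
    ∫ x, u x * ψ x = ∫ ξ, σ ((2 * Real.pi) • ξ) * (𝓕 φ) ξ * (𝓕⁻ ψ) ξ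

/-- The symbol `|∇a(ξ)|^{1/2} e^{i t a(ξ)}` of the operator `|∇a(D)|^{1/2} e^{i t a(D)}`. -/
def smoothingSymbol {n : ℕ} (a : RSpace n → ℝ) (t : ℝ) (ξ : RSpace n) : ℂ :=
  ((‖gradient a ξ‖ ^ (1 / 2 : ℝ) : ℝ) : ℂ) * Complex.exp (Complex.I * (t : ℂ) * (a ξ : ℂ))

/-- `IsSmoothedSolution a φ v` says that `v(t,x) = (|∇a(D)|^{1/2} e^{i t a(D)} φ)(x)` as a function on
`ℝ_t × ℝⁿ_x`: it is measurable in `(t,x)` up to null sets, and for almost every `t` the slice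
`v(t,·)` represents the tempered distribution on the right-hand side. -/
def IsSmoothedSolution {n : ℕ} (a : RSpace n → ℝ)
    (φ : Lp ℂ 2 (volume : Measure (RSpace n))) (v : ℝ × RSpace n → ℂ) : Prop :=
  AEStronglyMeasurable v (volume : Measure (ℝ × RSpace n)) ∧
  ∀ᵐ t : ℝ, IsFourierMultiplier (smoothingSymbol a t) φ (fun x => v (t, x))

end

/-! ### Integration along coordinate slices and change of variables by a polynomial -/

open scoped ENNReal

/-! The heart is a one-directional estimate. Fix a coordinate j and let h satisfy |h|² ≤ |∂_j a|
|g|². Expanding the square of the oscillatory integral of h against the weight (1 + x_j²)^(-s) gives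
a double integral over (ξ, η). Integration in t and in the other coordinates x_i formally produces
delta functions in a(ξ) - a(η) and ξ_i - η_i; in x_j the integrable weight contributes a bounded
factor. A Schur test with weight |∂_j a(η)| then needs only the substitution u = a(η) along lines
parallel to the j-th axis. Its Jacobian is exactly |∂_j a|, and each value is taken at most deg a
times off the critical points. In the code the deltas are Gaussians of mass at most 2π, so the
bounds are uniform in the regularization, which Fatou's lemma removes
(`lintegral_abs_derivative_mul_comp_le`, `lintegral_weighted_oscillatory_le`,
`lintegral_weighted_evolution_le`).

The vector |∇a|^{1/2} g is split into n pieces with coefficients |∂_j a| / ∑ |∂_k a|, each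
satisfying the hypothesis above. Since ⟨x⟩^(-2s) ≤ (1 + x_j²)^(-s), summing over j gives
`exists_lintegral_smoothedEvolution_le` for data whose integrals converge absolutely.

For general φ, the transform is truncated to balls. The estimate makes the weighted evolutions
Cauchy in L²(t,x). A subsequence converges in L²(x) for almost every t, and pairing with Schwartz
functions identifies the limit (`isFourierMultiplier_of_tendsto`). -/

theorem lintegral_pi_fin_prod {n : ℕ} (G : Fin n → ℝ → ℝ≥0∞) (hG : ∀ k, Measurable (G k)) :
    ∫⁻ y : Fin n → ℝ, ∏ k, G k (y k) = ∏ k, ∫⁻ u, G k u := by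
  induction n with
  | zero => simp [volume_pi]
  | succ m ih =>
    have hmp := (volume_preserving_piFinSuccAbove (fun _ : Fin (m + 1) => ℝ) 0).symm
    rw [← hmp.lintegral_comp_emb (MeasurableEquiv.measurableEmbedding _), Measure.volume_eq_prod]
    have : ∀ q : ℝ × (Fin m → ℝ),
        ∏ k, G k ((MeasurableEquiv.piFinSuccAbove (fun _ => ℝ) 0).symm q k)
          = G 0 q.1 * ∏ k : Fin m, G k.succ (q.2 k) := by
      intro q
      rw [Fin.prod_univ_succ]
      simp [MeasurableEquiv.piFinSuccAbove, Fin.insertNthEquiv]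
    simp_rw [this]
    have hP : Measurable fun y : Fin m → ℝ => ∏ k : Fin m, G k.succ (y k) :=
      Finset.measurable_fun_prod _ fun k _ => (hG k.succ).comp (measurable_pi_apply k)
    rw [lintegral_prod_mul (hG 0).aemeasurable hP.aemeasurable, ih _ fun k => hG k.succ, Fin.prod_univ_succ]

/-- Tonelli with the j-th variable integrated first: the slice bound is uniform in the remaining
variables, whose product integrand then factors. -/
theorem lintegral_pi_fin_le_of_slice {m : ℕ} (j : Fin (m + 1)) (G : Fin m → ℝ → ℝ≥0∞)
    (hG : ∀ k, Measurable (G k)) (Φ : (Fin (m + 1) → ℝ) → ℝ≥0∞) (hΦ : Measurable Φ) (S : ℝ≥0∞)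
    (h : ∀ y : Fin m → ℝ, ∫⁻ z, Φ (j.insertNth z y) ≤ S) :
    ∫⁻ η, (∏ k, G k (η (j.succAbove k))) * Φ η ≤ S * ∏ k, ∫⁻ u, G k u := by
  have hmp := (volume_preserving_piFinSuccAbove (fun _ : Fin (m + 1) => ℝ) j).symm
  rw [← hmp.lintegral_comp_emb (MeasurableEquiv.measurableEmbedding _), Measure.volume_eq_prod]
  have hP : Measurable fun y : Fin m → ℝ => ∏ k, G k (y k) :=
    Finset.measurable_fun_prod _ fun k _ => (hG k).comp (measurable_pi_apply k)
  have : ∀ q : ℝ × (Fin m → ℝ),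
      (∏ k, G k ((MeasurableEquiv.piFinSuccAbove (fun _ => ℝ) j).symm q (j.succAbove k)))
        * Φ ((MeasurableEquiv.piFinSuccAbove (fun _ => ℝ) j).symm q)
        = (∏ k, G k (q.2 k)) * Φ (j.insertNth q.1 q.2) := by
    intro q
    simp [MeasurableEquiv.piFinSuccAbove, Fin.insertNthEquiv]
  have hins : Measurable fun q : ℝ × (Fin m → ℝ) => Φ (j.insertNth q.1 q.2) :=
    hΦ.comp (MeasurableEquiv.piFinSuccAbove (fun _ => ℝ) j).symm.measurable
  simp_rw [this]
  have hmeas : Measurable fun q : ℝ × (Fin m → ℝ) => (∏ k, G k (q.2 k)) * Φ (j.insertNth q.1 q.2) :=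
    (hP.comp measurable_snd).mul hins
  rw [lintegral_prod_symm' _ hmeas]
  calc ∫⁻ y, ∫⁻ z, (∏ k, G k (y k)) * Φ (j.insertNth z y)
      = ∫⁻ y, (∏ k, G k (y k)) * ∫⁻ z, Φ (j.insertNth z y) := by
        refine lintegral_congr fun y => ?_
        exact lintegral_const_mul _ (hins.comp (measurable_id.prodMk measurable_const))
    _ ≤ ∫⁻ y : Fin m → ℝ, (∏ k, G k (y k)) * S := lintegral_mono fun y => mul_le_mul_right (h y) _
    _ = S * ∏ k, ∫⁻ u, G k u := by
        rw [lintegral_mul_const _ hP, lintegral_pi_fin_prod G hG, mul_comm]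

/-- Between consecutive critical points p is injective, so the change of variables u = p(z) applies
on each piece. A value u is hit by at most as many pieces as p - u has roots, hence by at most deg p
of them. -/
theorem lintegral_abs_derivative_mul_comp_le (p : Polynomial ℝ) (K : ℝ → ℝ≥0∞)
    (hK : Measurable K) :
    ∫⁻ z, ENNReal.ofReal |p.derivative.eval z| * K (p.eval z) ≤ p.natDegree * ∫⁻ u, K u := by
  classical
  by_cases hp : p.derivative = 0
  · simp [hp]
  have hpc : ∀ τ : ℝ, p - Polynomial.C τ ≠ 0 := by
    intro τ h
    apply hp
    rw [sub_eq_zero.1 h, Polynomial.derivative_C]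
  set S := p.derivative.roots.toFinset with hS
  -- A piece is labelled by the set of critical points to its left; this avoids ordering the roots.
  -- Labels that do not occur give empty pieces.
  set A : Finset ℝ → Set ℝ := fun T => {y | y ∉ S ∧ S.filter (· < y) = T} with hA
  have hAmeas : ∀ T, MeasurableSet (A T) := by
    intro T
    have hord : Set.OrdConnected {y : ℝ | S.filter (· < y) = T} := by
      refine ⟨fun x hx y hy z hz => ?_⟩
      simp only [Set.mem_ofPred_eq] at hx hy ⊢
      refine le_antisymm ?_ ?_
      · rw [← hy]
        exact Finset.monotone_filter_right _ fun r _ (hr : r < z) => hr.trans_le hz.2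
      · rw [← hx]
        exact Finset.monotone_filter_right _ fun r _ (hr : r < x) => hr.trans_le hz.1
    exact S.measurableSet.compl.inter hord.measurableSet
  have hinj : ∀ T, Set.InjOn (fun z => p.eval z) (A T) := by
    intro T
    have key : ∀ x ∈ A T, ∀ y ∈ A T, x < y → p.eval x ≠ p.eval y := by
      -- Rolle would put a critical point c strictly between x and y, so c would lie to the left of
      -- y but not of x, although both carry the same label.
      intro x hx y hy hxy he
      obtain ⟨c, hc, hc0⟩ := exists_deriv_eq_zero hxy p.continuous.continuousOn he
      rw [Polynomial.deriv] at hc0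
      have hcS : c ∈ S := by
        rw [hS, Multiset.mem_toFinset, Polynomial.mem_roots hp]; exact hc0
      have h1 : c ∈ S.filter (· < y) := Finset.mem_filter.2 ⟨hcS, hc.2⟩
      rw [hy.2, ← hx.2, Finset.mem_filter] at h1
      exact absurd h1.2 (not_lt.2 hc.1.le)
    intro x hx y hy he
    rcases lt_trichotomy x y with h | h | h
    · exact absurd he (key x hx y hy h)
    · exact h
    · exact absurd he.symm (key y hy x hx h)
  have hdisj : Set.PairwiseDisjoint (↑S.powerset) A := by
    intro T _ T' _ hne
    refine Set.disjoint_left.2 fun y hy hy' => hne ?_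
    rw [← hy.2, hy'.2]
  have hcover : (⋃ T ∈ S.powerset, A T) = {y | y ∉ S} := by
    ext y
    simp [A]
  have hae : (⋃ T ∈ S.powerset, A T) =ᵐ[volume] Set.univ := by
    rw [hcover]
    refine ae_eq_univ.2 ?_
    have : {y | y ∉ S}ᶜ = (S : Set ℝ) := by ext y; simp
    rw [this]
    exact S.finite_toSet.measure_zero volume
  have himg : ∀ T, MeasurableSet ((fun z => p.eval z) '' A T) := fun T =>
    (hAmeas T).image_of_continuousOn_injOn p.continuous.continuousOn (hinj T)
  rw [← setLIntegral_univ, ← setLIntegral_congr hae,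
    lintegral_biUnion_finset hdisj fun T _ => hAmeas T]
  have hchange : ∀ T, ∫⁻ z in A T, ENNReal.ofReal |p.derivative.eval z| * K (p.eval z)
      = ∫⁻ u, ((fun z => p.eval z) '' A T).indicator 1 u * K u := by
    intro T
    rw [← lintegral_image_eq_lintegral_abs_deriv_mul (hAmeas T)
      (fun x _ => (p.hasDerivAt x).hasDerivWithinAt) (hinj T), ← lintegral_indicator (himg T)]
    refine lintegral_congr fun u => ?_
    by_cases hu : u ∈ (fun z => p.eval z) '' A T <;> simp [hu]
  simp_rw [hchange]
  have hterm : ∀ T, Measurable fun u => ((fun z => p.eval z) '' A T).indicator 1 u * K u :=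
    fun T => (measurable_one.indicator (himg T)).mul hK
  rw [← lintegral_finsetSum _ fun T _ => hterm T, ← lintegral_const_mul _ hK]
  refine lintegral_mono fun u => ?_
  simp only
  rw [← Finset.sum_mul]
  gcongr
  have : ∑ T ∈ S.powerset, ((fun z => p.eval z) '' A T).indicator (1 : ℝ → ℝ≥0∞) u
      = ((S.powerset.filter fun T => u ∈ (fun z => p.eval z) '' A T).card : ℝ≥0∞) := by
    rw [Finset.card_filter, Nat.cast_sum]
    exact Finset.sum_congr rfl fun T _ => by simp [Set.indicator_apply]
  rw [this, Nat.cast_le]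
  -- One preimage of u is picked per piece hit; the pieces are disjoint, so these are distinct roots
  -- of p - u.
  have hchoice : ∀ T ∈ S.powerset.filter (fun T => u ∈ (fun z => p.eval z) '' A T),
      ∃ z, z ∈ A T ∧ p.eval z = u := fun T hT => (Finset.mem_filter.1 hT).2
  choose! r hr using hchoice
  calc _ ≤ (p - Polynomial.C u).roots.toFinset.card := by
        refine Finset.card_le_card_of_injOn r (fun T hT => ?_) (fun T hT T' hT' h => ?_)
        · simp [Polynomial.mem_roots (hpc u), (hr T hT).2]
        · rw [← (hr T hT).1.2, h, (hr T' hT').1.2]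
    _ ≤ (p - Polynomial.C u).roots.card := Multiset.toFinset_card_le _
    _ ≤ (p - Polynomial.C u).natDegree := Polynomial.card_roots' _
    _ = p.natDegree := Polynomial.natDegree_sub_C

/-! ### Gaussian kernels -/

/-- The absolute value of the Fourier transform `u ↦ ∫ exp (-δ x²) exp (i c u x) dx`. -/
noncomputable def gaussianKernel (c δ u : ℝ) : ℝ≥0∞ :=
  ENNReal.ofReal (Real.sqrt (Real.pi / δ) * Real.exp (-(c ^ 2 / (4 * δ)) * u ^ 2))

theorem measurable_gaussianKernel (c δ : ℝ) : Measurable (gaussianKernel c δ) := by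
  unfold gaussianKernel
  fun_prop

theorem gaussianKernel_sub_comm (c δ u v : ℝ) :
    gaussianKernel c δ (u - v) = gaussianKernel c δ (v - u) := by
  unfold gaussianKernel
  rw [sub_sq_comm]

theorem enorm_integral_gaussian_phase {c δ : ℝ} (hδ : 0 < δ) (u : ℝ) :
    ‖∫ x : ℝ, ((Real.exp (-δ * x ^ 2) : ℝ) : ℂ) * Complex.exp (Complex.I * (c * u * x : ℝ))‖ₑ
      = gaussianKernel c δ u := by
  have h := fourierIntegral_gaussian (b := (δ : ℂ)) (by simpa using hδ) ((c * u : ℝ) : ℂ)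
  have : ∀ x : ℝ, ((Real.exp (-δ * x ^ 2) : ℝ) : ℂ) * Complex.exp (Complex.I * (c * u * x : ℝ))
      = Complex.exp (Complex.I * ((c * u : ℝ) : ℂ) * x) * Complex.exp (-(δ : ℂ) * x ^ 2) := by
    intro x
    rw [mul_comm]
    push_cast
    ring_nf
  simp_rw [this]
  rw [h, gaussianKernel, ← ofReal_norm, norm_mul, Complex.norm_exp]
  congr 2
  · rw [← Complex.ofReal_div, Complex.norm_cpow_eq_rpow_re_of_pos (by positivity), Real.sqrt_eq_rpow]
    norm_num
  · congr 1
    have : -(((c * u : ℝ) : ℂ)) ^ 2 / (4 * (δ : ℂ)) = ((-(c ^ 2 / (4 * δ)) * u ^ 2 : ℝ) : ℂ) := by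
      push_cast; field_simp
    rw [this, Complex.ofReal_re]

/-- The mass is exactly 2π / c, independent of δ. Both c = 1 (time) and c = 2π (space, from the
Fourier normalization) are covered by one bound. -/
theorem lintegral_gaussianKernel_le {c δ : ℝ} (hc : 1 ≤ c) (hδ : 0 < δ) :
    ∫⁻ u : ℝ, gaussianKernel c δ u ≤ ENNReal.ofReal (2 * Real.pi) := by
  have hb : 0 < c ^ 2 / (4 * δ) := by positivity
  unfold gaussianKernel
  rw [← ofReal_integral_eq_lintegral_ofReal ((integrable_exp_neg_mul_sq hb).const_mul _)
    (Filter.Eventually.of_forall fun u => by positivity), integral_const_mul, integral_gaussian]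
  apply ENNReal.ofReal_le_ofReal
  rw [← Real.sqrt_mul (by positivity)]
  refine Real.sqrt_le_iff.2 ⟨by positivity, ?_⟩
  have : Real.pi / δ * (Real.pi / (c ^ 2 / (4 * δ))) = (2 * Real.pi) ^ 2 / c ^ 2 := by
    field_simp; ring
  rw [this]
  exact div_le_self (by positivity) (one_le_pow₀ hc)

/-! ### A Schur test for oscillatory integrals -/

/-- A weighted AM-GM inequality, from (pq)(rt) = (rq)(pt). It distributes the Schur weight without
dividing by it, so zeros of the weight cause no trouble. -/
theorem ENNReal.mul_le_add_of_sq_le {x y p q r t : ℝ≥0∞} (hx : x ^ 2 ≤ p * q)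
    (hy : y ^ 2 ≤ r * t) : x * y ≤ r * q + p * t := by
  have h : (x * y) ^ 2 ≤ (r * q + p * t) ^ 2 := by
    calc (x * y) ^ 2 = x ^ 2 * y ^ 2 := mul_pow _ _ _
      _ ≤ (p * q) * (r * t) := mul_le_mul' hx hy
      _ = (r * q) * (p * t) := by ring
      _ ≤ (r * q + p * t) * (r * q + p * t) := mul_le_mul' le_self_add le_add_self
      _ = _ := (sq _).symm
  exact (ENNReal.pow_le_pow_left_iff two_ne_zero).1 h

section Schur

variable {X Y : Type*} [MeasurableSpace X] [MeasurableSpace Y] {μ : Measure X} {ν : Measure Y}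
  [SFinite μ] [SFinite ν]

/-- Writing the squared modulus as a double integral and integrating in y first leaves a kernel
dominated by k. The product |h(ξ)||h(η)| is bounded by b(η)γ(ξ) + b(ξ)γ(η), and by symmetry of k
each term costs S ∫ γ. Integrability of w and h is what licenses Fubini. -/
theorem lintegral_weighted_oscillatory_le {w : Y → ℝ} (hw : Integrable w ν) (hw0 : ∀ y, 0 ≤ w y)
    {θ : Y → X → ℝ} (hθ : Measurable (Function.uncurry θ)) {h : X → ℂ} (hh : Integrable h μ)
    {b γ : X → ℝ≥0∞} (hb : Measurable b) (hγ : Measurable γ)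
    (hhg : ∀ ξ, ‖h ξ‖ₑ ^ 2 ≤ b ξ * γ ξ) {k : X → X → ℝ≥0∞} (hkm : Measurable (Function.uncurry k))
    (hk : ∀ ξ η, ‖∫ y, (w y : ℂ) * Complex.exp (Complex.I * (θ y ξ - θ y η : ℝ)) ∂ν‖ₑ ≤ k ξ η)
    (hksymm : ∀ ξ η, k ξ η = k η ξ) {S : ℝ≥0∞} (hS : ∀ ξ, ∫⁻ η, k ξ η * b η ∂μ ≤ S) :
    ∫⁻ y, ENNReal.ofReal (w y) * ‖∫ ξ, Complex.exp (Complex.I * (θ y ξ : ℝ)) * h ξ ∂μ‖ₑ ^ 2 ∂ν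
      ≤ 2 * S * ∫⁻ ξ, γ ξ ∂μ := by
  set F : Y → ℂ := fun y => ∫ ξ, Complex.exp (Complex.I * (θ y ξ : ℝ)) * h ξ ∂μ with hF
  set H : X × X → ℂ := fun p => h p.1 * (starRingEnd ℂ) (h p.2) with hH
  set e : Y → X × X → ℂ := fun y p => Complex.exp (Complex.I * (θ y p.1 - θ y p.2 : ℝ)) with he
  have hHint : Integrable H (μ.prod μ) :=
    hh.mul_prod (f := h) (g := fun ξ => (starRingEnd ℂ) (h ξ))
      ((Complex.conjCLE : ℂ →L[ℝ] ℂ).integrable_comp hh)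
  have hem : Measurable (Function.uncurry e) := by
    have h1 : Measurable fun q : Y × X × X => θ q.1 q.2.1 :=
      hθ.comp (measurable_fst.prodMk (measurable_fst.comp measurable_snd))
    have h2 : Measurable fun q : Y × X × X => θ q.1 q.2.2 :=
      hθ.comp (measurable_fst.prodMk (measurable_snd.comp measurable_snd))
    exact Complex.measurable_exp.comp
      ((Complex.measurable_ofReal.comp (h1.sub h2)).const_mul Complex.I)
  have henorm : ∀ y p, ‖e y p‖ = 1 := fun y p => by
    rw [he]; simp only; rw [mul_comm, Complex.norm_exp_ofReal_mul_I]
  have hFF : ∀ y, ((‖F y‖ ^ 2 : ℝ) : ℂ) = ∫ p, e y p * H p ∂(μ.prod μ) := by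
    intro y
    have : ∀ p, e y p * H p = (Complex.exp (Complex.I * (θ y p.1 : ℝ)) * h p.1)
        * (starRingEnd ℂ) (Complex.exp (Complex.I * (θ y p.2 : ℝ)) * h p.2) := by
      intro p
      simp only [he, hH, map_mul, ← Complex.exp_conj, Complex.conj_I, Complex.conj_ofReal]
      rw [Complex.ofReal_sub, mul_sub, Complex.exp_sub, neg_mul, Complex.exp_neg]
      ring
    simp_rw [this]
    rw [integral_prod_mul (fun ξ => Complex.exp (Complex.I * (θ y ξ : ℝ)) * h ξ)
      (fun ξ => (starRingEnd ℂ) (Complex.exp (Complex.I * (θ y ξ : ℝ)) * h ξ)), integral_conj,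
      Complex.mul_conj, Complex.normSq_eq_norm_sq]
  have hint : Integrable (Function.uncurry fun (y : Y) (p : X × X) => (w y : ℂ) * (e y p * H p))
      (ν.prod (μ.prod μ)) := by
    have h0 : Integrable (fun q : Y × X × X => (w q.1 : ℂ) * H q.2) (ν.prod (μ.prod μ)) :=
      Integrable.mul_prod (f := fun y => (w y : ℂ)) hw.ofReal hHint
    refine (h0.bdd_mul (c := 1) hem.aestronglyMeasurable
      (Filter.Eventually.of_forall fun q => (henorm q.1 q.2).le)).congr
      (Filter.Eventually.of_forall fun q => ?_)
    simp only [Function.uncurry]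
    ring
  have hJc : ∀ y, ((w y * ‖F y‖ ^ 2 : ℝ) : ℂ) = ∫ p, (w y : ℂ) * (e y p * H p) ∂(μ.prod μ) := by
    intro y
    rw [integral_const_mul, ← hFF, Complex.ofReal_mul]
  have hJint : Integrable (fun y => w y * ‖F y‖ ^ 2) ν := by
    have := hint.integral_prod_left.re
    refine this.congr (Filter.Eventually.of_forall fun y => ?_)
    have h2 := hJc y
    simp only [Function.uncurry]
    rw [← h2]
    exact Complex.ofReal_re _
  have hlhs : ∫⁻ y, ENNReal.ofReal (w y) * ‖F y‖ₑ ^ 2 ∂ν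
      = ENNReal.ofReal (∫ y, w y * ‖F y‖ ^ 2 ∂ν) := by
    rw [ofReal_integral_eq_lintegral_ofReal hJint
      (Filter.Eventually.of_forall fun y => mul_nonneg (hw0 y) (by positivity))]
    refine lintegral_congr fun y => ?_
    rw [ENNReal.ofReal_mul (hw0 y), ENNReal.ofReal_pow (norm_nonneg _), ofReal_norm]
  have hJ : ((∫ y, w y * ‖F y‖ ^ 2 ∂ν : ℝ) : ℂ)
      = ∫ p : X × X, H p * ∫ y, (w y : ℂ) * e y p ∂ν ∂(μ.prod μ) := by
    rw [← integral_complex_ofReal]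
    simp_rw [hJc]
    rw [integral_integral_swap hint]
    refine integral_congr_ae (Filter.Eventually.of_forall fun p => ?_)
    simp only
    rw [← integral_const_mul]
    refine integral_congr_ae (Filter.Eventually.of_forall fun y => ?_)
    simp only
    ring
  rw [hlhs]
  have hm1 : Measurable fun p : X × X => k p.1 p.2 * (b p.2 * γ p.1) :=
    hkm.mul ((hb.comp measurable_snd).mul (hγ.comp measurable_fst))
  have hm2 : Measurable fun p : X × X => k p.1 p.2 * (b p.1 * γ p.2) :=
    hkm.mul ((hb.comp measurable_fst).mul (hγ.comp measurable_snd))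
  have hbd : ∀ ξ, ∫⁻ η, k ξ η * (b η * γ ξ) ∂μ ≤ S * γ ξ := by
    intro ξ
    simp_rw [← mul_assoc]
    have hm : Measurable fun η => k ξ η * b η := (hkm.comp measurable_prodMk_left).mul hb
    rw [lintegral_mul_const _ hm]
    exact mul_le_mul_left (hS ξ) _
  calc ENNReal.ofReal (∫ y, w y * ‖F y‖ ^ 2 ∂ν)
      ≤ ‖((∫ y, w y * ‖F y‖ ^ 2 ∂ν : ℝ) : ℂ)‖ₑ := by
        rw [← ofReal_norm, Complex.norm_real]
        exact ENNReal.ofReal_le_ofReal (le_abs_self _)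
    _ ≤ ∫⁻ p : X × X, ‖H p * ∫ y, (w y : ℂ) * e y p ∂ν‖ₑ ∂(μ.prod μ) := by
        rw [hJ]
        exact enorm_integral_le_lintegral_enorm _
    _ ≤ ∫⁻ p : X × X, (k p.1 p.2 * (b p.2 * γ p.1) + k p.1 p.2 * (b p.1 * γ p.2)) ∂(μ.prod μ) := by
        refine lintegral_mono fun p => ?_
        simp only [hH, enorm_mul]
        have hc : ‖(starRingEnd ℂ) (h p.2)‖ₑ = ‖h p.2‖ₑ := by
          rw [← ofReal_norm, RCLike.norm_conj, ofReal_norm]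
        rw [hc, ← mul_add, mul_comm]
        exact mul_le_mul' (hk p.1 p.2) (ENNReal.mul_le_add_of_sq_le (hhg p.1) (hhg p.2))
    -- The second term is integrated in the opposite order, so that symmetry of k turns it into a
    -- copy of the first.
    _ = (∫⁻ ξ, ∫⁻ η, k ξ η * (b η * γ ξ) ∂μ ∂μ) + ∫⁻ η, ∫⁻ ξ, k η ξ * (b ξ * γ η) ∂μ ∂μ := by
        rw [lintegral_add_left hm1, lintegral_prod _ hm1.aemeasurable, lintegral_prod_symm' _ hm2]
        simp_rw [fun ξ η => hksymm ξ η]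
    _ ≤ (∫⁻ ξ, S * γ ξ ∂μ) + ∫⁻ ξ, S * γ ξ ∂μ :=
        add_le_add (lintegral_mono hbd) (lintegral_mono hbd)
    _ = 2 * S * ∫⁻ ξ, γ ξ ∂μ := by rw [lintegral_const_mul _ hγ]; ring

end Schur

theorem Complex.enorm_finsetProd {ι : Type*} (S : Finset ι) (f : ι → ℂ) :
    ‖∏ i ∈ S, f i‖ₑ = ∏ i ∈ S, ‖f i‖ₑ := by
  simp only [enorm_eq_nnnorm, nnnorm_prod]
  push_cast
  rfl

/-! ### Local smoothing in one coordinate direction -/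

section LocalSmoothing

variable {m : ℕ}

/-- The phase of the oscillatory integral representing `exp (i t A(D)) φ (x)`. -/
noncomputable def evolutionPhase {n : ℕ} (A : (Fin n → ℝ) → ℝ) (q : ℝ × (Fin n → ℝ))
    (ξ : Fin n → ℝ) : ℝ :=
  q.1 * A ξ + 2 * Real.pi * ∑ k, q.2 k * ξ k

theorem measurable_evolutionPhase {n : ℕ} {A : (Fin n → ℝ) → ℝ} (hA : Measurable A) :
    Measurable (Function.uncurry (evolutionPhase A)) := by
  unfold evolutionPhase Function.uncurry
  fun_prop

/-- The factors of the weight that regularizes `(1 + x_j²)^(-s)` in the other coordinates. -/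
noncomputable def weightFactor (j : Fin m) (s δ : ℝ) (k : Fin m) (u : ℝ) : ℝ :=
  if k = j then (1 + u ^ 2) ^ (-s) else Real.exp (-δ * u ^ 2)

theorem weightFactor_nonneg (j : Fin m) (s δ : ℝ) (k : Fin m) (u : ℝ) :
    0 ≤ weightFactor j s δ k u := by
  unfold weightFactor
  split_ifs <;> positivity

theorem integrable_one_add_sq_rpow_neg {s : ℝ} (hs : 1 / 2 < s) :
    Integrable fun u : ℝ => (1 + u ^ 2) ^ (-s) := by
  have := integrable_rpow_neg_one_add_norm_sq (E := ℝ) (μ := volume) (r := 2 * s)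
    (by simp; linarith)
  refine this.congr (Filter.Eventually.of_forall fun u => ?_)
  simp only [Real.norm_eq_abs, sq_abs]
  congr 1
  ring

theorem integrable_weightFactor (j : Fin m) {s δ : ℝ} (hs : 1 / 2 < s) (hδ : 0 < δ) (k : Fin m) :
    Integrable (weightFactor j s δ k) := by
  unfold weightFactor
  split_ifs
  · exact integrable_one_add_sq_rpow_neg hs
  · exact integrable_exp_neg_mul_sq hδ

/-- The weight is a product, so the Schur kernel factors into one-dimensional Fourier integrals.
Hypothesis `hM` is the change of variables along the j-th axis; the resulting bound does not depend
on δ. -/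
theorem lintegral_regularized_evolution_le (j : Fin (m + 1)) {s δ : ℝ} (hs : 1 / 2 < s)
    (hδ : 0 < δ) {A B : (Fin (m + 1) → ℝ) → ℝ} (hA : Measurable A) (hB : Measurable B) {M : ℝ≥0∞}
    (hM : ∀ (y : Fin m → ℝ) (K : ℝ → ℝ≥0∞), Measurable K →
      ∫⁻ z, ENNReal.ofReal |B (j.insertNth z y)| * K (A (j.insertNth z y)) ≤ M * ∫⁻ u, K u)
    {h : (Fin (m + 1) → ℝ) → ℂ} (hh : Integrable h) {γ : (Fin (m + 1) → ℝ) → ℝ≥0∞}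
    (hγ : Measurable γ) (hhγ : ∀ ξ, ‖h ξ‖ₑ ^ 2 ≤ ENNReal.ofReal |B ξ| * γ ξ) :
    ∫⁻ q : ℝ × (Fin (m + 1) → ℝ),
        ENNReal.ofReal (Real.exp (-δ * q.1 ^ 2) * ∏ k, weightFactor j s δ k (q.2 k))
          * ‖∫ ξ, Complex.exp (Complex.I * (evolutionPhase A q ξ : ℝ)) * h ξ‖ₑ ^ 2
      ≤ 2 * (ENNReal.ofReal (∫ u : ℝ, (1 + u ^ 2) ^ (-s))
          * (M * ENNReal.ofReal (2 * Real.pi) * ENNReal.ofReal (2 * Real.pi) ^ m))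
          * ∫⁻ ξ, γ ξ := by
  set W := ENNReal.ofReal (∫ u : ℝ, (1 + u ^ 2) ^ (-s)) with hW
  set k : (Fin (m + 1) → ℝ) → (Fin (m + 1) → ℝ) → ℝ≥0∞ := fun ξ η =>
    W * ((∏ i : Fin m, gaussianKernel (2 * Real.pi) δ (ξ (j.succAbove i) - η (j.succAbove i)))
      * gaussianKernel 1 δ (A ξ - A η)) with hk
  have hGm := measurable_gaussianKernel
  have hkm : Measurable (Function.uncurry k) := by
    refine Measurable.const_mul (Measurable.mul
      (Finset.measurable_fun_prod _ fun i _ => (hGm _ _).comp ?_) ((hGm _ _).comp ?_)) _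
    · fun_prop
    · fun_prop
  have h2pi : 1 ≤ 2 * Real.pi := by linarith [Real.pi_gt_three]
  rw [Measure.volume_eq_prod]
  refine lintegral_weighted_oscillatory_le (k := k) (b := fun ξ => ENNReal.ofReal |B ξ|)
    (w := fun q : ℝ × (Fin (m + 1) → ℝ) =>
      Real.exp (-δ * q.1 ^ 2) * ∏ k, weightFactor j s δ k (q.2 k)) ?_ ?_
    (measurable_evolutionPhase hA) hh (by fun_prop) hγ hhγ hkm ?_ ?_ ?_
  · exact (integrable_exp_neg_mul_sq hδ).mul_prod
      (Integrable.fintype_prod (f := weightFactor j s δ) fun i => integrable_weightFactor j hs hδ i)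
  · exact fun q => mul_nonneg (Real.exp_pos _).le
      (Finset.prod_nonneg fun i _ => weightFactor_nonneg _ _ _ _ _)
  · intro ξ η
    have hsplit : ∀ q : ℝ × (Fin (m + 1) → ℝ),
        ((Real.exp (-δ * q.1 ^ 2) * ∏ k, weightFactor j s δ k (q.2 k) : ℝ) : ℂ)
          * Complex.exp (Complex.I * (evolutionPhase A q ξ - evolutionPhase A q η : ℝ))
        = (((Real.exp (-δ * q.1 ^ 2) : ℝ) : ℂ)
            * Complex.exp (Complex.I * (1 * (A ξ - A η) * q.1 : ℝ)))
          * ∏ k, ((weightFactor j s δ k (q.2 k) : ℂ)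
            * Complex.exp (Complex.I * (2 * Real.pi * (ξ k - η k) * q.2 k : ℝ))) := by
      intro q
      rw [Finset.prod_mul_distrib, ← Complex.exp_sum, ← Finset.mul_sum, ← Complex.ofReal_sum]
      have : evolutionPhase A q ξ - evolutionPhase A q η
          = 1 * (A ξ - A η) * q.1 + ∑ k, 2 * Real.pi * (ξ k - η k) * q.2 k := by
        unfold evolutionPhase
        have hsum : ∑ k, 2 * Real.pi * (ξ k - η k) * q.2 k
            = 2 * Real.pi * ∑ k, q.2 k * ξ k - 2 * Real.pi * ∑ k, q.2 k * η k := by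
          rw [Finset.mul_sum, Finset.mul_sum, ← Finset.sum_sub_distrib]
          exact Finset.sum_congr rfl fun k _ => by ring
        rw [hsum]; ring
      rw [this, Complex.ofReal_add, mul_add, Complex.exp_add, Complex.ofReal_mul,
        Complex.ofReal_prod]
      ring
    simp_rw [hsplit]
    rw [integral_prod_mul
      (fun t : ℝ => ((Real.exp (-δ * t ^ 2) : ℝ) : ℂ)
        * Complex.exp (Complex.I * (1 * (A ξ - A η) * t : ℝ)))
      (fun x : Fin (m + 1) → ℝ => ∏ k, ((weightFactor j s δ k (x k) : ℂ)
            * Complex.exp (Complex.I * (2 * Real.pi * (ξ k - η k) * x k : ℝ)))),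
      volume_pi, integral_fintype_prod_eq_prod (fun (k : Fin (m + 1)) (u : ℝ) =>
        ((weightFactor j s δ k u : ℂ)
            * Complex.exp (Complex.I * (2 * Real.pi * (ξ k - η k) * u : ℝ)))),
      enorm_mul, enorm_integral_gaussian_phase hδ, Fin.prod_univ_succAbove _ j, enorm_mul,
      Complex.enorm_finsetProd]
    -- In direction j no oscillation is used: the phase is discarded and the integral is bounded by
    -- the mass of the weight, finite because s > 1/2.
    have hj : ‖∫ u : ℝ, (weightFactor j s δ j u : ℂ)
        * Complex.exp (Complex.I * (2 * Real.pi * (ξ j - η j) * u : ℝ))‖ₑ ≤ W := by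
      refine (enorm_integral_le_lintegral_enorm _).trans ?_
      rw [hW, ofReal_integral_eq_lintegral_ofReal (integrable_one_add_sq_rpow_neg hs)
        (Filter.Eventually.of_forall fun u => by positivity)]
      refine lintegral_mono fun u => ?_
      rw [← ofReal_norm, norm_mul, mul_comm Complex.I, Complex.norm_exp_ofReal_mul_I, mul_one,
        Complex.norm_real, Real.norm_of_nonneg (weightFactor_nonneg _ _ _ _ _), weightFactor,
        if_pos rfl]
    have hi : ∀ i : Fin m, ‖∫ u : ℝ, (weightFactor j s δ (j.succAbove i) u : ℂ)
        * Complex.exp (Complex.I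
          * (2 * Real.pi * (ξ (j.succAbove i) - η (j.succAbove i)) * u : ℝ))‖ₑ
        = gaussianKernel (2 * Real.pi) δ (ξ (j.succAbove i) - η (j.succAbove i)) := by
      intro i
      simp only [weightFactor, if_neg (Fin.succAbove_ne j i)]
      exact enorm_integral_gaussian_phase hδ _
    simp_rw [hi]
    rw [hk]
    simp only
    calc _ ≤ gaussianKernel 1 δ (A ξ - A η) * (W * _) := by gcongr
      _ = _ := by ring
  · intro ξ η
    simp only [hk, gaussianKernel_sub_comm _ _ (ξ _), gaussianKernel_sub_comm _ _ (A ξ)]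
  · intro ξ
    have hΦ : Measurable fun η => gaussianKernel 1 δ (A ξ - A η) * ENNReal.ofReal |B η| :=
      ((hGm _ _).comp (by fun_prop)).mul (by fun_prop)
    have hG : ∀ i : Fin m, Measurable fun u : ℝ =>
        gaussianKernel (2 * Real.pi) δ (ξ (j.succAbove i) - u) := fun i =>
      (hGm _ _).comp (by fun_prop)
    have hfac : ∀ η, k ξ η * ENNReal.ofReal |B η| = W *
        ((∏ i : Fin m, gaussianKernel (2 * Real.pi) δ (ξ (j.succAbove i) - η (j.succAbove i)))
          * (gaussianKernel 1 δ (A ξ - A η) * ENNReal.ofReal |B η|)) := by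
      intro η; simp only [hk]; ring
    simp_rw [hfac]
    have hmeas : Measurable fun η : Fin (m + 1) → ℝ =>
        (∏ i : Fin m, gaussianKernel (2 * Real.pi) δ (ξ (j.succAbove i) - η (j.succAbove i)))
          * (gaussianKernel 1 δ (A ξ - A η) * ENNReal.ofReal |B η|) :=
      (Finset.measurable_fun_prod _ fun i _ => (hG i).comp (measurable_pi_apply _)).mul hΦ
    rw [lintegral_const_mul _ hmeas]
    gcongr
    refine (lintegral_pi_fin_le_of_slice j
      (fun i u => gaussianKernel (2 * Real.pi) δ (ξ (j.succAbove i) - u)) hG _ hΦ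
      (M * ENNReal.ofReal (2 * Real.pi)) fun y => ?_).trans ?_
    · simp_rw [mul_comm (gaussianKernel _ _ _)]
      -- The slice integral of |B| times the Gaussian in A becomes an integral over the values of A,
      -- where translation invariance removes the dependence on ξ.
      refine (hM y (fun u => gaussianKernel 1 δ (A ξ - u)) ((hGm _ _).comp (by fun_prop))).trans ?_
      rw [lintegral_sub_left_eq_self (gaussianKernel 1 δ)]
      gcongr
      exact lintegral_gaussianKernel_le le_rfl hδ
    · gcongr
      calc _ ≤ ∏ _i : Fin m, ENNReal.ofReal (2 * Real.pi) := by
            refine Finset.prod_le_prod' fun i _ => ?_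
            rw [lintegral_sub_left_eq_self (gaussianKernel (2 * Real.pi) δ)]
            exact lintegral_gaussianKernel_le h2pi hδ
        _ = _ := by simp

theorem measurable_evolution_integral {n : ℕ} {A : (Fin n → ℝ) → ℝ} (hA : Measurable A)
    {h : (Fin n → ℝ) → ℂ} (hh : Measurable h) :
    Measurable fun q => ∫ ξ, Complex.exp (Complex.I * (evolutionPhase A q ξ : ℝ)) * h ξ := by
  refine StronglyMeasurable.measurable
    (StronglyMeasurable.integral_prod_right (Measurable.stronglyMeasurable ?_))
  exact (Complex.measurable_exp.comp ((Complex.measurable_ofReal.comp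
    (measurable_evolutionPhase hA)).const_mul Complex.I)).mul (hh.comp measurable_snd)

/-- Letting δ = 1/(N+1) tend to 0 removes the Gaussian cutoffs: the integrands converge pointwise,
and Fatou's lemma preserves the bound, which is uniform in δ. -/
theorem lintegral_weighted_evolution_le (j : Fin (m + 1)) {s : ℝ} (hs : 1 / 2 < s)
    {A B : (Fin (m + 1) → ℝ) → ℝ} (hA : Measurable A) (hB : Measurable B) {M : ℝ≥0∞}
    (hM : ∀ (y : Fin m → ℝ) (K : ℝ → ℝ≥0∞), Measurable K →
      ∫⁻ z, ENNReal.ofReal |B (j.insertNth z y)| * K (A (j.insertNth z y)) ≤ M * ∫⁻ u, K u)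
    {h : (Fin (m + 1) → ℝ) → ℂ} (hhm : Measurable h) (hh : Integrable h)
    {γ : (Fin (m + 1) → ℝ) → ℝ≥0∞}
    (hγ : Measurable γ) (hhγ : ∀ ξ, ‖h ξ‖ₑ ^ 2 ≤ ENNReal.ofReal |B ξ| * γ ξ) :
    ∫⁻ q : ℝ × (Fin (m + 1) → ℝ), ENNReal.ofReal ((1 + q.2 j ^ 2) ^ (-s))
          * ‖∫ ξ, Complex.exp (Complex.I * (evolutionPhase A q ξ : ℝ)) * h ξ‖ₑ ^ 2
      ≤ 2 * (ENNReal.ofReal (∫ u : ℝ, (1 + u ^ 2) ^ (-s))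
          * (M * ENNReal.ofReal (2 * Real.pi) * ENNReal.ofReal (2 * Real.pi) ^ m))
          * ∫⁻ ξ, γ ξ := by
  set D : ℕ → ℝ := fun N => 1 / ((N : ℝ) + 1) with hD
  have hD0 : ∀ N, 0 < D N := fun N => by simp only [hD]; positivity
  have hDlim : Filter.Tendsto D Filter.atTop (nhds 0) := tendsto_one_div_add_atTop_nhds_zero_nat
  have hFm := measurable_evolution_integral hA hhm
  set f : ℕ → ℝ × (Fin (m + 1) → ℝ) → ℝ≥0∞ := fun N q =>
    ENNReal.ofReal (Real.exp (-D N * q.1 ^ 2) * ∏ k, weightFactor j s (D N) k (q.2 k))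
      * ‖∫ ξ, Complex.exp (Complex.I * (evolutionPhase A q ξ : ℝ)) * h ξ‖ₑ ^ 2 with hf
  have hwm : ∀ N k, Measurable (weightFactor j s (D N) k) := fun N k => by
    unfold weightFactor
    split_ifs <;> fun_prop
  have hfm : ∀ N, Measurable (f N) := by
    intro N
    refine Measurable.mul (Measurable.ennreal_ofReal (Measurable.mul (by fun_prop)
      (Finset.measurable_fun_prod _ fun k _ => (hwm N k).comp (by fun_prop)))) ?_
    exact hFm.enorm.pow_const 2
  have hexp : ∀ u : ℝ, Filter.Tendsto (fun N => Real.exp (-D N * u ^ 2)) Filter.atTop (nhds 1) := by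
    intro u
    have : Filter.Tendsto (fun N => -D N * u ^ 2) Filter.atTop (nhds (-0 * u ^ 2)) :=
      hDlim.neg.mul_const _
    have h2 := (Real.continuous_exp.tendsto _).comp this
    simpa [Function.comp_def] using h2
  have hlim : ∀ q : ℝ × (Fin (m + 1) → ℝ), Filter.Tendsto (fun N => f N q) Filter.atTop
      (nhds (ENNReal.ofReal ((1 + q.2 j ^ 2) ^ (-s))
          * ‖∫ ξ, Complex.exp (Complex.I * (evolutionPhase A q ξ : ℝ)) * h ξ‖ₑ ^ 2)) := by
    intro q
    refine ENNReal.Tendsto.mul_const (ENNReal.tendsto_ofReal ?_)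
      (Or.inr (ENNReal.pow_ne_top enorm_ne_top))
    have hprod : Filter.Tendsto (fun N => ∏ k, weightFactor j s (D N) k (q.2 k)) Filter.atTop
        (nhds (∏ k, if k = j then (1 + q.2 k ^ 2) ^ (-s) else 1)) := by
      refine tendsto_finsetProd _ fun k _ => ?_
      unfold weightFactor
      split_ifs
      · exact tendsto_const_nhds
      · exact hexp _
    have := (hexp q.1).mul hprod
    simpa using this
  calc _ = ∫⁻ q, Filter.liminf (fun N => f N q) Filter.atTop :=
        lintegral_congr fun q => (hlim q).liminf_eq.symm
    _ ≤ Filter.liminf (fun N => ∫⁻ q, f N q) Filter.atTop := lintegral_liminf_le hfm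
    _ ≤ _ := Filter.liminf_le_of_le (by isBoundedDefault) fun b hb => by
        obtain ⟨N, hN⟩ := hb.exists
        exact hN.trans (lintegral_regularized_evolution_le j hs (hD0 N) hA hB hM hh hγ hhγ)

end LocalSmoothing

/-! ### Calculus of the polynomial symbol -/

/-- The chain rule in algebraic form, needed to differentiate the restriction of a to a line as a
one-variable polynomial. -/
theorem Polynomial.derivative_mvPolynomial_aeval {σ R : Type*} [Fintype σ] [DecidableEq σ]
    [CommRing R] (f : σ → Polynomial R) (a : MvPolynomial σ R) :
    (MvPolynomial.aeval f a).derivative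
      = ∑ k, MvPolynomial.aeval f (MvPolynomial.pderiv k a) * (f k).derivative := by
  induction a using MvPolynomial.induction_on with
  | C r => simp [Polynomial.algebraMap_eq]
  | add p q hp hq => simp [hp, hq, add_mul, Finset.sum_add_distrib]
  | mul_X p i hp =>
    have hk : ∀ k, MvPolynomial.aeval f (MvPolynomial.pderiv k (p * MvPolynomial.X i))
          * (f k).derivative
        = MvPolynomial.aeval f (MvPolynomial.pderiv k p) * (f k).derivative * f i
          + if k = i then MvPolynomial.aeval f p * (f i).derivative else 0 := by
      intro k
      by_cases hki : k = i
      · subst hki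
        simp
        ring
      · simp [hki, Ne.symm hki]
        ring
    rw [Finset.sum_congr rfl fun k _ => hk k, Finset.sum_add_distrib, ← Finset.sum_mul, ← hp,
      Finset.sum_ite_eq' Finset.univ i, if_pos (Finset.mem_univ _), map_mul, MvPolynomial.aeval_X,
      Polynomial.derivative_mul]

/-- The gradient of the polynomial `a`, as a vector of polynomial functions. -/
noncomputable def polyGradient {n : ℕ} (a : MvPolynomial (Fin n) ℝ) (ξ : RSpace n) : RSpace n :=
  WithLp.toLp 2 fun k => polySymbol (MvPolynomial.pderiv k a) ξ

theorem hasFDerivAt_polySymbol {n : ℕ} (a : MvPolynomial (Fin n) ℝ) (ξ : RSpace n) :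
    HasFDerivAt (polySymbol a) (∑ k, polySymbol (MvPolynomial.pderiv k a) ξ •
      (EuclideanSpace.proj k : RSpace n →L[ℝ] ℝ)) ξ := by
  induction a using MvPolynomial.induction_on with
  | C r =>
    have h : polySymbol (MvPolynomial.C r : MvPolynomial (Fin n) ℝ) = fun _ => r := by
      ext; simp [polySymbol]
    rw [h]
    refine (hasFDerivAt_const r ξ).congr_fderiv ?_
    simp [polySymbol]
  | add p q hp hq =>
    have h : polySymbol (p + q) = polySymbol p + polySymbol q := by
      ext; simp [polySymbol]
    rw [h]
    refine (hp.add hq).congr_fderiv ?_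
    simp [polySymbol, add_smul, Finset.sum_add_distrib]
  | mul_X p i hp =>
    have h : polySymbol (p * MvPolynomial.X i) = polySymbol p * fun ξ => ξ i := by
      ext; simp [polySymbol]
    rw [h]
    have hi : HasFDerivAt (fun ξ : RSpace n => ξ i) (EuclideanSpace.proj i : RSpace n →L[ℝ] ℝ) ξ :=
      (EuclideanSpace.proj i : RSpace n →L[ℝ] ℝ).hasFDerivAt
    refine (hp.mul hi).congr_fderiv ?_
    have hk : ∀ k, polySymbol (MvPolynomial.pderiv k (p * MvPolynomial.X i)) ξ •
          (EuclideanSpace.proj k : RSpace n →L[ℝ] ℝ)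
        = (if k = i then polySymbol p ξ • (EuclideanSpace.proj i : RSpace n →L[ℝ] ℝ) else 0)
          + ξ i • (polySymbol (MvPolynomial.pderiv k p) ξ •
            (EuclideanSpace.proj k : RSpace n →L[ℝ] ℝ)) := by
      intro k
      rw [smul_smul]
      by_cases hki : k = i
      · subst hki
        simp [polySymbol, add_smul]
      · simp [polySymbol, hki, Ne.symm hki]
    simp_rw [hk]
    rw [Finset.sum_add_distrib, Finset.sum_ite_eq' Finset.univ i, if_pos (Finset.mem_univ _),
      Finset.smul_sum]

theorem hasGradientAt_polySymbol {n : ℕ} (a : MvPolynomial (Fin n) ℝ) (ξ : RSpace n) :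
    HasGradientAt (polySymbol a) (polyGradient a ξ) ξ := by
  rw [hasGradientAt_iff_hasFDerivAt]
  refine (hasFDerivAt_polySymbol a ξ).congr_fderiv ?_
  ext v
  simp [polyGradient, PiLp.inner_apply, mul_comm]

theorem gradient_polySymbol {n : ℕ} (a : MvPolynomial (Fin n) ℝ) :
    gradient (polySymbol a) = polyGradient a := by
  ext1 ξ
  exact (hasGradientAt_polySymbol a ξ).gradient

theorem continuous_polySymbol {n : ℕ} (a : MvPolynomial (Fin n) ℝ) : Continuous (polySymbol a) := by
  unfold polySymbol
  exact (MvPolynomial.continuous_eval a).comp (by fun_prop)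

theorem continuous_polyGradient {n : ℕ} (a : MvPolynomial (Fin n) ℝ) :
    Continuous (polyGradient a) := by
  unfold polyGradient
  exact (PiLp.continuous_toLp 2 _).comp (continuous_pi fun k => continuous_polySymbol _)

theorem hasTemperateGrowth_polySymbol {n : ℕ} (a : MvPolynomial (Fin n) ℝ) :
    (polySymbol a).HasTemperateGrowth := by
  induction a using MvPolynomial.induction_on with
  | C r =>
    have h : polySymbol (MvPolynomial.C r : MvPolynomial (Fin n) ℝ) = fun _ => r := by
      ext; simp [polySymbol]
    rw [h]
    exact .const r
  | add p q hp hq =>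
    have h : polySymbol (p + q) = fun ξ => polySymbol p ξ + polySymbol q ξ := by
      ext; simp [polySymbol]
    rw [h]
    exact hp.add hq
  | mul_X p i hp =>
    have h : polySymbol (p * MvPolynomial.X i) = fun ξ => polySymbol p ξ * ξ i := by
      ext; simp [polySymbol]
    rw [h]
    exact hp.mul (EuclideanSpace.proj i : RSpace n →L[ℝ] ℝ).hasTemperateGrowth

theorem norm_polyGradient_le {n : ℕ} (a : MvPolynomial (Fin n) ℝ) (ξ : RSpace n) :
    ‖polyGradient a ξ‖ ≤ ∑ k, |polySymbol (MvPolynomial.pderiv k a) ξ| := by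
  have h : polyGradient a ξ = ∑ k, EuclideanSpace.single k
      (polySymbol (MvPolynomial.pderiv k a) ξ) := by
    ext i
    simp [polyGradient]
  rw [h]
  refine (norm_sum_le _ _).trans (Finset.sum_le_sum fun k _ => ?_)
  simp

theorem continuous_smoothingSymbol {n : ℕ} (a : MvPolynomial (Fin n) ℝ) (t : ℝ) :
    Continuous (smoothingSymbol (polySymbol a) t) := by
  unfold smoothingSymbol
  rw [gradient_polySymbol]
  have h1 := (continuous_polyGradient a).norm.rpow_const (p := 1 / 2)
    fun _ => Or.inr (by norm_num)
  have h2 := continuous_polySymbol a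
  fun_prop

theorem norm_smoothingSymbol {n : ℕ} (a : MvPolynomial (Fin n) ℝ) (t : ℝ) (ξ : RSpace n) :
    ‖smoothingSymbol (polySymbol a) t ξ‖ = ‖polyGradient a ξ‖ ^ (1 / 2 : ℝ) := by
  rw [smoothingSymbol, gradient_polySymbol, norm_mul, Complex.norm_real,
    Real.norm_of_nonneg (by positivity), mul_assoc, ← Complex.ofReal_mul, mul_comm Complex.I,
    Complex.norm_exp_ofReal_mul_I, mul_one]

/-- The symbol need not be smooth where ∇a vanishes, so the product need not be Schwartz. Its
modulus is at most 1 + ∑ |∂_k a|, and polynomials times Schwartz functions are Schwartz, hence in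
L². -/
theorem memLp_smoothingSymbol_mul_schwartz {n : ℕ} (a : MvPolynomial (Fin n) ℝ) (t : ℝ)
    (ψ : 𝓢(RSpace n, ℂ)) :
    MemLp (fun ξ => smoothingSymbol (polySymbol a) t ((2 * Real.pi) • ξ) * ψ ξ) 2 volume := by
  have hk : ∀ k, MemLp (fun ξ =>
      |polySymbol (MvPolynomial.pderiv k a) ((2 * Real.pi) • ξ)| * ‖ψ ξ‖) 2 volume := by
    intro k
    have hg : (fun ξ : RSpace n => polySymbol (MvPolynomial.pderiv k a)
        ((2 * Real.pi) • ξ)).HasTemperateGrowth :=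
      (hasTemperateGrowth_polySymbol _).comp
        ((2 * Real.pi) • ContinuousLinearMap.id ℝ (RSpace n)).hasTemperateGrowth
    have h := ((SchwartzMap.smulLeftCLM ℂ
      (fun ξ : RSpace n => polySymbol (MvPolynomial.pderiv k a) ((2 * Real.pi) • ξ)) ψ).memLp
      2 volume).norm
    refine (memLp_congr_ae (Filter.Eventually.of_forall fun ξ => ?_)).1 h
    rw [SchwartzMap.smulLeftCLM_apply_apply hg, norm_smul, Real.norm_eq_abs]
  refine ((ψ.memLp 2 volume).norm.add (memLp_finsetSum Finset.univ fun k _ => hk k)).of_le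
    (((continuous_smoothingSymbol a t).comp (by fun_prop)).mul ψ.continuous).aestronglyMeasurable
    (Filter.Eventually.of_forall fun ξ => ?_)
  set L := ‖polyGradient a ((2 * Real.pi) • ξ)‖ with hL
  have hL1 : L ^ (1 / 2 : ℝ) ≤ 1 + L := by
    rw [← Real.sqrt_eq_rpow]
    refine Real.sqrt_le_iff.2 ⟨by positivity, ?_⟩
    nlinarith [norm_nonneg (polyGradient a ((2 * Real.pi) • ξ))]
  rw [norm_mul, norm_smoothingSymbol, Pi.add_apply, ← Finset.sum_mul, Real.norm_of_nonneg]
  · calc L ^ (1 / 2 : ℝ) * ‖ψ ξ‖ ≤ (1 + L) * ‖ψ ξ‖ := by gcongr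
      _ ≤ (1 + ∑ k, |polySymbol (MvPolynomial.pderiv k a) ((2 * Real.pi) • ξ)|) * ‖ψ ξ‖ := by
        gcongr
        exact norm_polyGradient_le a _
      _ = _ := by ring
  · positivity

theorem lintegral_pderiv_mul_polySymbol_le {m : ℕ} (a : MvPolynomial (Fin (m + 1)) ℝ)
    (j : Fin (m + 1)) (y : Fin m → ℝ) (K : ℝ → ℝ≥0∞) (hK : Measurable K) :
    ∫⁻ z, ENNReal.ofReal |polySymbol (MvPolynomial.pderiv j a)
          ((2 * Real.pi) • WithLp.toLp 2 (j.insertNth z y : Fin (m + 1) → ℝ))|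
        * K (polySymbol a ((2 * Real.pi) • WithLp.toLp 2 (j.insertNth z y : Fin (m + 1) → ℝ)))
      ≤ a.totalDegree * ∫⁻ u, K u := by
  -- Substituting f restricts a(2π ·) to the line through y parallel to the j-th axis; every entry
  -- has degree at most 1, so the degree does not exceed that of a.
  set f : Fin (m + 1) → Polynomial ℝ := j.insertNth (Polynomial.C (2 * Real.pi) * Polynomial.X)
    (fun i => Polynomial.C (2 * Real.pi * y i)) with hf
  have heval : ∀ (b : MvPolynomial (Fin (m + 1)) ℝ) (z : ℝ), (MvPolynomial.aeval f b).eval z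
      = polySymbol b ((2 * Real.pi) • WithLp.toLp 2 (j.insertNth z y : Fin (m + 1) → ℝ)) := by
    intro b z
    rw [← Polynomial.coe_evalRingHom, MvPolynomial.aeval_def, MvPolynomial.hom_eval₂, polySymbol,
      MvPolynomial.eval, MvPolynomial.coe_eval₂Hom]
    congr 1
    · ext; simp [Polynomial.algebraMap_eq]
    · ext k
      refine Fin.succAboveCases j ?_ (fun i => ?_) k <;> simp [hf]
  have hder : ∀ z, (MvPolynomial.aeval f a).derivative.eval z = 2 * Real.pi *
      polySymbol (MvPolynomial.pderiv j a)
        ((2 * Real.pi) • WithLp.toLp 2 (j.insertNth z y : Fin (m + 1) → ℝ)) := by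
    intro z
    rw [Polynomial.derivative_mvPolynomial_aeval, Fin.sum_univ_succAbove _ j, ← heval]
    simp [hf, mul_comm]
  have hdeg : (MvPolynomial.aeval f a).natDegree ≤ a.totalDegree := by
    have := MvPolynomial.aeval_natDegree_le a le_rfl f (n := 1) fun k => by
      refine Fin.succAboveCases j ?_ (fun i => ?_) k
      · simp only [hf, Fin.insertNth_apply_same]
        exact (Polynomial.natDegree_C_mul_le _ _).trans Polynomial.natDegree_X_le
      · simp only [hf, Fin.insertNth_apply_succAbove, Polynomial.natDegree_C, zero_le]
    simpa using this
  calc _ ≤ ∫⁻ z, ENNReal.ofReal |(MvPolynomial.aeval f a).derivative.eval z|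
        * K ((MvPolynomial.aeval f a).eval z) := by
        refine lintegral_mono fun z => ?_
        simp only [heval, hder, abs_mul]
        gcongr
        -- The chain rule factor 2π exceeds 1 and is simply dropped.
        refine le_mul_of_one_le_left (abs_nonneg _) ?_
        rw [abs_of_nonneg Real.pi_pos.le]
        norm_num
        linarith [Real.pi_gt_three]
    _ ≤ _ := lintegral_abs_derivative_mul_comp_le _ K hK
    _ ≤ _ := by gcongr

/-! ### Splitting into directions and the estimate for integrable data -/

/-- The function `|∇a(D)|^{1/2} exp (i t a(D)) 𝓕⁻ g`, given by an absolutely convergent integral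
when `|∇a|^{1/2} g` is integrable. -/
noncomputable def smoothedEvolution {n : ℕ} (a : MvPolynomial (Fin n) ℝ) (g : RSpace n → ℂ)
    (q : ℝ × RSpace n) : ℂ :=
  𝓕⁻ (fun ξ => smoothingSymbol (polySymbol a) q.1 ((2 * Real.pi) • ξ) * g ξ) q.2

theorem continuous_sqrt_norm_polyGradient {n : ℕ} (a : MvPolynomial (Fin n) ℝ) :
    Continuous fun ξ => ‖polyGradient a ξ‖ ^ (1 / 2 : ℝ) :=
  (continuous_polyGradient a).norm.rpow_const fun _ => Or.inr (by norm_num)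

/-- Used with P = |∂_j a|, Q = ∑ |∂_k a| and L = |∇a|: one factor P/Q and the factor L/Q are at most
1. When Q = 0, division by zero gives 0. -/
theorem div_mul_rpow_half_sq_le {P Q L : ℝ} (hP : 0 ≤ P) (hPQ : P ≤ Q) (hL : 0 ≤ L) (hLQ : L ≤ Q) :
    (P / Q * L ^ (1 / 2 : ℝ)) ^ 2 ≤ P := by
  rw [mul_pow, ← Real.sqrt_eq_rpow, Real.sq_sqrt hL, div_pow]
  rcases (hP.trans hPQ).eq_or_lt with hQ | hQ
  · rw [← hQ]; simpa using hP
  · rw [div_mul_eq_mul_div, div_le_iff₀ (by positivity), sq, sq, mul_assoc]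
    exact mul_le_mul_of_nonneg_left (mul_le_mul hPQ hLQ hL hQ.le) hP

theorem enorm_sum_sq_le {ι : Type*} (S : Finset ι) (f : ι → ℂ) :
    ‖∑ i ∈ S, f i‖ₑ ^ 2 ≤ S.card * ∑ i ∈ S, ‖f i‖ₑ ^ 2 := by
  have h : ‖∑ i ∈ S, f i‖₊ ^ 2 ≤ S.card * ∑ i ∈ S, ‖f i‖₊ ^ 2 :=
    (pow_le_pow_left₀ zero_le (nnnorm_sum_le S f) 2).trans sq_sum_le_card_mul_sum_sq
  simp only [enorm_eq_nnnorm]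
  exact_mod_cast h

section Directional

variable {n : ℕ} (a : MvPolynomial (Fin n) ℝ) (g : RSpace n → ℂ)

/-- The polynomial function `b` in the variable `2 π ξ`, on `Fin n → ℝ`. -/
noncomputable def scaledSymbol (b : MvPolynomial (Fin n) ℝ) (ξ : Fin n → ℝ) : ℝ :=
  polySymbol b ((2 * Real.pi) • WithLp.toLp 2 ξ)

theorem continuous_two_pi_smul_toLp :
    Continuous fun ξ : Fin n → ℝ => (2 * Real.pi) • (WithLp.toLp 2 ξ : RSpace n) := by
  fun_prop

theorem continuous_scaledSymbol (b : MvPolynomial (Fin n) ℝ) : Continuous (scaledSymbol b) :=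
  (continuous_polySymbol b).comp continuous_two_pi_smul_toLp

/-- The part of `|∇a|^{1/2} g` on which the derivative of `a` in the direction `j` is used. -/
noncomputable def directionalPart (j : Fin n) (ξ : Fin n → ℝ) : ℂ :=
  ((|scaledSymbol (MvPolynomial.pderiv j a) ξ|
      / (∑ k, |scaledSymbol (MvPolynomial.pderiv k a) ξ|)
      * ‖polyGradient a ((2 * Real.pi) • WithLp.toLp 2 ξ)‖ ^ (1 / 2 : ℝ) : ℝ) : ℂ)
    * g (WithLp.toLp 2 ξ)

theorem sum_directionalPart (ξ : Fin n → ℝ) :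
    ∑ j, directionalPart a g j ξ
      = ((‖polyGradient a ((2 * Real.pi) • WithLp.toLp 2 ξ)‖ ^ (1 / 2 : ℝ) : ℝ) : ℂ)
        * g (WithLp.toLp 2 ξ) := by
  unfold directionalPart
  rw [← Finset.sum_mul, ← Complex.ofReal_sum, ← Finset.sum_mul, ← Finset.sum_div]
  congr 2
  -- Where all partial derivatives vanish the quotients are 0 instead of summing to 1, but there the
  -- factor |∇a|^{1/2} is 0 too.
  by_cases h : ∑ k, |scaledSymbol (MvPolynomial.pderiv k a) ξ| = 0
  · have h0 : ‖polyGradient a ((2 * Real.pi) • WithLp.toLp 2 ξ)‖ = 0 :=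
      le_antisymm ((norm_polyGradient_le a _).trans h.le) (norm_nonneg _)
    rw [h0, Real.zero_rpow (by norm_num), mul_zero]
  · rw [div_self h, one_mul]

theorem measurable_directionalPart (hg : Measurable g) (j : Fin n) :
    Measurable (directionalPart a g j) := by
  have h1 : ∀ k, Measurable fun ξ => |scaledSymbol (MvPolynomial.pderiv k a) ξ| := fun k =>
    (continuous_scaledSymbol _).abs.measurable
  have h2 : Measurable fun ξ : Fin n → ℝ =>
      ‖polyGradient a ((2 * Real.pi) • WithLp.toLp 2 ξ)‖ ^ (1 / 2 : ℝ) :=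
    ((continuous_sqrt_norm_polyGradient a).comp continuous_two_pi_smul_toLp).measurable
  have h3 : Measurable fun ξ : Fin n → ℝ => g (WithLp.toLp 2 ξ) :=
    hg.comp (PiLp.continuous_toLp 2 _).measurable
  exact (Complex.measurable_ofReal.comp
    (((h1 j).div (Finset.measurable_fun_sum _ fun k _ => h1 k)).mul h2)).mul h3

theorem norm_directionalPart_le (j : Fin n) (ξ : Fin n → ℝ) :
    ‖directionalPart a g j ξ‖
      ≤ ‖polyGradient a ((2 * Real.pi) • WithLp.toLp 2 ξ)‖ ^ (1 / 2 : ℝ)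
        * ‖g (WithLp.toLp 2 ξ)‖ := by
  have hle : |scaledSymbol (MvPolynomial.pderiv j a) ξ|
      ≤ ∑ k, |scaledSymbol (MvPolynomial.pderiv k a) ξ| :=
    Finset.single_le_sum (f := fun k => |scaledSymbol (MvPolynomial.pderiv k a) ξ|)
      (fun k _ => abs_nonneg _) (Finset.mem_univ j)
  rw [directionalPart, norm_mul, Complex.norm_real, Real.norm_of_nonneg (by positivity)]
  gcongr
  exact mul_le_of_le_one_left (by positivity) (div_le_one_of_le₀ hle (by positivity))

theorem enorm_directionalPart_sq_le (j : Fin n) (ξ : Fin n → ℝ) :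
    ‖directionalPart a g j ξ‖ₑ ^ 2
      ≤ ENNReal.ofReal |scaledSymbol (MvPolynomial.pderiv j a) ξ|
        * ‖g (WithLp.toLp 2 ξ)‖ₑ ^ 2 := by
  have hle : |scaledSymbol (MvPolynomial.pderiv j a) ξ|
      ≤ ∑ k, |scaledSymbol (MvPolynomial.pderiv k a) ξ| :=
    Finset.single_le_sum (f := fun k => |scaledSymbol (MvPolynomial.pderiv k a) ξ|)
      (fun k _ => abs_nonneg _) (Finset.mem_univ j)
  have hL : ‖polyGradient a ((2 * Real.pi) • WithLp.toLp 2 ξ)‖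
      ≤ ∑ k, |scaledSymbol (MvPolynomial.pderiv k a) ξ| := norm_polyGradient_le a _
  rw [directionalPart, enorm_mul, mul_pow]
  gcongr
  rw [← ofReal_norm, Complex.norm_real, Real.norm_of_nonneg (by positivity),
    ← ENNReal.ofReal_pow (by positivity)]
  apply ENNReal.ofReal_le_ofReal
  exact div_mul_rpow_half_sq_le (abs_nonneg _) hle (norm_nonneg _) hL

theorem integrable_directionalPart (hg : Measurable g) (hint : Integrable fun ξ =>
      ‖polyGradient a ((2 * Real.pi) • ξ)‖ ^ (1 / 2 : ℝ) * ‖g ξ‖) (j : Fin n) :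
    Integrable (directionalPart a g j) := by
  have h := (PiLp.volume_preserving_toLp (Fin n)).integrable_comp_of_integrable hint
  refine h.mono' (measurable_directionalPart a g hg j).aestronglyMeasurable
    (Filter.Eventually.of_forall fun ξ => norm_directionalPart_le a g j ξ)

theorem smoothedEvolution_eq_sum (hg : Measurable g) (hint : Integrable fun ξ =>
      ‖polyGradient a ((2 * Real.pi) • ξ)‖ ^ (1 / 2 : ℝ) * ‖g ξ‖) (t : ℝ) (x : Fin n → ℝ) :
    smoothedEvolution a g (t, WithLp.toLp 2 x)
      = ∑ j, ∫ ξ, Complex.exp (Complex.I * (evolutionPhase (scaledSymbol a) (t, x) ξ : ℝ))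
          * directionalPart a g j ξ := by
  have hj := integrable_directionalPart a g hg hint
  have hexp : Measurable fun ξ : Fin n → ℝ =>
      Complex.exp (Complex.I * (evolutionPhase (scaledSymbol a) (t, x) ξ : ℝ)) :=
    Complex.measurable_exp.comp ((Complex.measurable_ofReal.comp
      ((measurable_evolutionPhase (continuous_scaledSymbol a).measurable).comp
        measurable_prodMk_left)).const_mul Complex.I)
  rw [← integral_finsetSum _ fun j _ => (hj j).bdd_mul (c := 1) hexp.aestronglyMeasurable
      (Filter.Eventually.of_forall fun ξ => by
        rw [mul_comm Complex.I, Complex.norm_exp_ofReal_mul_I]),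
    smoothedEvolution, Real.fourierInv_eq',
    ← (PiLp.volume_preserving_toLp (Fin n)).integral_comp
      (MeasurableEquiv.toLp 2 (Fin n → ℝ)).measurableEmbedding]
  refine integral_congr_ae (Filter.Eventually.of_forall fun ξ => ?_)
  simp only
  rw [← Finset.mul_sum, sum_directionalPart, smoothingSymbol, gradient_polySymbol, evolutionPhase,
    smul_eq_mul, PiLp.inner_apply]
  have h1 : Complex.exp (Complex.I * ((t * scaledSymbol a ξ
        + 2 * Real.pi * ∑ k, x k * ξ k : ℝ) : ℂ))
      = Complex.exp (((2 * Real.pi * ∑ k, x k * ξ k : ℝ) : ℂ) * Complex.I)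
        * Complex.exp (Complex.I * t * (scaledSymbol a ξ : ℝ)) := by
    rw [← Complex.exp_add]
    push_cast
    ring_nf
  rw [h1]
  simp only [RCLike.inner_apply, conj_trivial, scaledSymbol]
  ring

end Directional

theorem measurable_smoothedEvolution {n : ℕ} (a : MvPolynomial (Fin n) ℝ) {g : RSpace n → ℂ}
    (hg : Measurable g) : Measurable (smoothedEvolution a g) := by
  unfold smoothedEvolution
  simp_rw [Real.fourierInv_eq']
  refine StronglyMeasurable.measurable
    (StronglyMeasurable.integral_prod_right (Measurable.stronglyMeasurable ?_))
  have h1 := (continuous_sqrt_norm_polyGradient a).measurable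
  have h1' : Measurable fun p : (ℝ × RSpace n) × RSpace n =>
      ‖polyGradient a ((2 * Real.pi) • p.2)‖ ^ (1 / 2 : ℝ) := h1.comp (by fun_prop)
  have h2 := (continuous_polySymbol a).measurable
  have h2' : Measurable fun p : (ℝ × RSpace n) × RSpace n =>
      polySymbol a ((2 * Real.pi) • p.2) := h2.comp (by fun_prop)
  have h3 : Measurable fun p : (ℝ × RSpace n) × RSpace n => inner ℝ p.2 p.1.2 :=
    (measurable_snd.inner (measurable_snd.comp measurable_fst))
  have h4 : Measurable fun p : (ℝ × RSpace n) × RSpace n => g p.2 := hg.comp measurable_snd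
  simp only [smul_eq_mul, smoothingSymbol, gradient_polySymbol, Function.uncurry_def]
  fun_prop

theorem exists_lintegral_smoothedEvolution_le {m : ℕ} (a : MvPolynomial (Fin (m + 1)) ℝ) {s : ℝ}
    (hs : 1 / 2 < s) : ∃ C : ℝ≥0∞, C ≠ ∞ ∧ ∀ g : RSpace (m + 1) → ℂ, Measurable g →
      (Integrable fun ξ => ‖polyGradient a ((2 * Real.pi) • ξ)‖ ^ (1 / 2 : ℝ) * ‖g ξ‖) →
      ∫⁻ q : ℝ × RSpace (m + 1), ENNReal.ofReal ((1 + ‖q.2‖ ^ 2) ^ (-s))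
        * ‖smoothedEvolution a g q‖ₑ ^ 2 ≤ C * ∫⁻ ξ, ‖g ξ‖ₑ ^ 2 := by
  set C₀ : ℝ≥0∞ := 2 * (ENNReal.ofReal (∫ u : ℝ, (1 + u ^ 2) ^ (-s))
    * (a.totalDegree * ENNReal.ofReal (2 * Real.pi) * ENNReal.ofReal (2 * Real.pi) ^ m)) with hC₀
  -- One factor m + 1 comes from Cauchy-Schwarz for the sum of the pieces, the other from adding the
  -- m + 1 directional bounds.
  refine ⟨(m + 1 : ℕ) * ((m + 1 : ℕ) * C₀), by finiteness, fun g hg hint => ?_⟩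
  have hmp : MeasurePreserving (Prod.map id (WithLp.toLp 2) :
      ℝ × (Fin (m + 1) → ℝ) → ℝ × RSpace (m + 1)) volume volume :=
    (MeasurePreserving.id volume).prod (PiLp.volume_preserving_toLp (Fin (m + 1)))
  have hmeas : Measurable fun q : ℝ × RSpace (m + 1) => ENNReal.ofReal ((1 + ‖q.2‖ ^ 2) ^ (-s))
        * ‖smoothedEvolution a g q‖ₑ ^ 2 :=
    Measurable.mul (by fun_prop) ((measurable_smoothedEvolution a hg).enorm.pow_const 2)
  have hcore : ∀ j : Fin (m + 1), ∫⁻ q : ℝ × (Fin (m + 1) → ℝ),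
      ENNReal.ofReal ((1 + q.2 j ^ 2) ^ (-s))
        * ‖∫ ξ, Complex.exp (Complex.I * (evolutionPhase (scaledSymbol a) q ξ : ℝ))
            * directionalPart a g j ξ‖ₑ ^ 2 ≤ C₀ * ∫⁻ ξ, ‖g ξ‖ₑ ^ 2 := by
    intro j
    have hγ : Measurable fun ξ : RSpace (m + 1) => ‖g ξ‖ₑ ^ 2 := hg.enorm.pow_const 2
    rw [← (PiLp.volume_preserving_toLp (Fin (m + 1))).lintegral_comp hγ]
    exact lintegral_weighted_evolution_le j hs (continuous_scaledSymbol a).measurable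
      (continuous_scaledSymbol _).measurable
      (fun y K hK => lintegral_pderiv_mul_polySymbol_le a j y K hK)
      (measurable_directionalPart a g hg j) (integrable_directionalPart a g hg hint j)
      (hγ.comp (PiLp.continuous_toLp 2 _).measurable) (enorm_directionalPart_sq_le a g j)
  have hmj : ∀ j : Fin (m + 1), Measurable fun q : ℝ × (Fin (m + 1) → ℝ) =>
      ENNReal.ofReal ((1 + q.2 j ^ 2) ^ (-s))
        * ‖∫ ξ, Complex.exp (Complex.I * (evolutionPhase (scaledSymbol a) q ξ : ℝ))
            * directionalPart a g j ξ‖ₑ ^ 2 := fun j =>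
    Measurable.mul (by fun_prop) ((measurable_evolution_integral
      (continuous_scaledSymbol a).measurable (measurable_directionalPart a g hg j)).enorm.pow_const 2)
  rw [← hmp.lintegral_comp hmeas]
  calc _ ≤ ∫⁻ q : ℝ × (Fin (m + 1) → ℝ), (m + 1 : ℕ) * ∑ j,
        ENNReal.ofReal ((1 + q.2 j ^ 2) ^ (-s))
        * ‖∫ ξ, Complex.exp (Complex.I * (evolutionPhase (scaledSymbol a) q ξ : ℝ))
            * directionalPart a g j ξ‖ₑ ^ 2 := by
        refine lintegral_mono fun q => ?_
        simp only [Prod.map, id]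
        rw [smoothedEvolution_eq_sum a g hg hint]
        refine (mul_le_mul_right (enorm_sum_sq_le _ _) _).trans ?_
        rw [Finset.card_univ, Fintype.card_fin, mul_left_comm, Finset.mul_sum]
        refine mul_le_mul_right (Finset.sum_le_sum fun j _ =>
          mul_le_mul_left (ENNReal.ofReal_le_ofReal ?_) _) _
        -- The exponent is negative and |x_j| ≤ |x|, so the full weight is dominated by the one in
        -- x_j alone.
        refine Real.rpow_le_rpow_of_nonpos (by positivity) ?_ (by linarith only [hs])
        have := PiLp.norm_apply_le (WithLp.toLp 2 q.2 : RSpace (m + 1)) j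
        rw [Real.norm_eq_abs] at this
        gcongr 1 + ?_
        rw [← sq_abs (q.2 j)]
        gcongr
    _ = (m + 1 : ℕ) * ∑ j, ∫⁻ q : ℝ × (Fin (m + 1) → ℝ),
        ENNReal.ofReal ((1 + q.2 j ^ 2) ^ (-s))
        * ‖∫ ξ, Complex.exp (Complex.I * (evolutionPhase (scaledSymbol a) q ξ : ℝ))
            * directionalPart a g j ξ‖ₑ ^ 2 := by
        rw [lintegral_const_mul _ (Finset.measurable_fun_sum _ fun j _ => hmj j),
          lintegral_finsetSum _ fun j _ => hmj j]
    _ ≤ (m + 1 : ℕ) * ∑ _j : Fin (m + 1), C₀ * ∫⁻ ξ, ‖g ξ‖ₑ ^ 2 := by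
        gcongr with j _
        exact hcore j
    _ = _ := by
        rw [Finset.sum_const, Finset.card_univ, Fintype.card_fin, nsmul_eq_mul]
        ring

/-! ### Convergence in L², duality and weights -/

theorem eLpNorm_two_sq {α : Type*} [MeasurableSpace α] {μ : Measure α} (f : α → ℂ) :
    eLpNorm f 2 μ ^ 2 = ∫⁻ x, ‖f x‖ₑ ^ 2 ∂μ := by
  have := eLpNorm_nnreal_pow_eq_lintegral (f := f) (μ := μ) (p := 2) two_ne_zero
  simpa using this

theorem tendsto_eLpNorm_two_iff {α : Type*} [MeasurableSpace α] {μ : Measure α} (f : ℕ → α → ℂ) :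
    Filter.Tendsto (fun k => eLpNorm (f k) 2 μ) Filter.atTop (nhds 0) ↔
      Filter.Tendsto (fun k => ∫⁻ x, ‖f k x‖ₑ ^ 2 ∂μ) Filter.atTop (nhds 0) := by
  simp_rw [← eLpNorm_two_sq]
  constructor
  · intro h
    simpa using ENNReal.Tendsto.pow (n := 2) h
  · intro h
    have h2 := h.ennrpow_const (1 / 2 : ℝ)
    simp_rw [← ENNReal.rpow_natCast, ← ENNReal.rpow_mul] at h2
    simpa using h2

theorem exists_subseq_ae_tendsto_zero {α : Type*} [MeasurableSpace α] {μ : Measure α}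
    {H : ℕ → α → ℝ≥0∞} (hH : ∀ k, Measurable (H k))
    (h : Filter.Tendsto (fun k => ∫⁻ x, H k x ∂μ) Filter.atTop (nhds 0)) :
    ∃ ns : ℕ → ℕ, StrictMono ns ∧
      ∀ᵐ x ∂μ, Filter.Tendsto (fun k => H (ns k) x) Filter.atTop (nhds 0) := by
  have hpos : ∀ n : ℕ, (0 : ℝ≥0∞) < 2⁻¹ ^ n := fun n => ENNReal.pow_pos (by simp) n
  -- With integrals at most 2^(-n) along the subsequence, the sum of the functions is integrable,
  -- hence finite almost everywhere, so its terms tend to 0.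
  obtain ⟨ns, hns, hle⟩ := Filter.extraction_forall_of_eventually fun n =>
    h.eventually_le_const (hpos n)
  refine ⟨ns, hns, ?_⟩
  have hsum : ∫⁻ x, ∑' k, H (ns k) x ∂μ ≠ ∞ := by
    rw [lintegral_tsum fun k => (hH _).aemeasurable]
    refine ne_top_of_le_ne_top ?_ (ENNReal.tsum_le_tsum hle)
    rw [ENNReal.tsum_geometric_two]
    exact ENNReal.ofNat_ne_top
  filter_upwards [ae_lt_top (Measurable.tsum fun k => hH (ns k)) hsum] with x hx
  exact ENNReal.tendsto_atTop_zero_of_tsum_ne_top hx.ne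

theorem tendsto_integral_mul_of_eLpNorm_two {α : Type*} [MeasurableSpace α] {μ : Measure α}
    {f : ℕ → α → ℂ} {f₀ w : α → ℂ} (hf : ∀ k, AEStronglyMeasurable (f k) μ) (hf₀ : MemLp f₀ 2 μ)
    (hw : MemLp w 2 μ)
    (h : Filter.Tendsto (fun k => eLpNorm (fun x => f k x - f₀ x) 2 μ) Filter.atTop (nhds 0)) :
    Filter.Tendsto (fun k => ∫ x, f k x * w x ∂μ) Filter.atTop (nhds (∫ x, f₀ x * w x ∂μ)) := by
  have hd : ∀ k, AEStronglyMeasurable (fun x => f k x - f₀ x) μ := fun k => (hf k).sub hf₀.1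
  refine tendsto_integral_of_L1 _ (hf₀.integrable_mul hw).1 ?_ ?_
  -- The f k are not assumed square integrable; finiteness of the distance to f₀ makes them so for
  -- large k.
  · filter_upwards [h.eventually_lt_const ENNReal.zero_lt_top] with k hk
    have hk' : MemLp (fun x => f k x - f₀ x) 2 μ := ⟨hd k, hk⟩
    refine ((hk'.integrable_mul hw).add (hf₀.integrable_mul hw)).congr
      (Filter.Eventually.of_forall fun x => ?_)
    simp only [Pi.add_apply, Pi.mul_apply]
    ring
  · have hlim := ENNReal.Tendsto.mul_const h (Or.inr hw.2.ne)
    rw [zero_mul] at hlim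
    refine tendsto_of_tendsto_of_tendsto_of_le_of_le tendsto_const_nhds hlim (fun k => zero_le)
      fun k => ?_
    have := eLpNorm_smul_le_mul_eLpNorm (r := 1) hw.1 (hd k) (p := 2) (q := 2)
    rw [eLpNorm_one_eq_lintegral_enorm] at this
    refine le_trans (le_of_eq (lintegral_congr fun x => ?_)) this
    simp [sub_mul]

theorem integral_fourierInv_mul_eq_of_integrable {n : ℕ} {f ψ : RSpace n → ℂ} (hf : Integrable f)
    (hψ : Integrable ψ) : ∫ x, 𝓕⁻ f x * ψ x = ∫ ξ, f ξ * 𝓕⁻ ψ ξ := by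
  have h : ∫ x, 𝓕 (fun ξ => f (-ξ)) x * ψ x = ∫ ξ, f (-ξ) * 𝓕 ψ ξ := by
    simpa using! VectorFourier.integral_fourierIntegral_smul_eq_flip (L := innerₗ (RSpace n))
      Real.continuous_fourierChar continuous_inner hf.comp_neg hψ
  rw [Real.fourierInv_eq_fourier_comp_neg, h, ← integral_neg_eq_self]
  simp [Real.fourierInv_eq_fourier_neg]

theorem japaneseBracket_pos {n : ℕ} (x : RSpace n) : 0 < japaneseBracket x :=
  Real.sqrt_pos.2 (by positivity)

theorem japaneseBracket_rpow {n : ℕ} (x : RSpace n) (r : ℝ) :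
    japaneseBracket x ^ r = (1 + ‖x‖ ^ 2) ^ (r / 2) := by
  rw [japaneseBracket, Real.sqrt_eq_rpow, ← Real.rpow_mul (by positivity)]
  ring_nf

theorem continuous_japaneseBracket_rpow {n : ℕ} (r : ℝ) :
    Continuous fun x : RSpace n => japaneseBracket x ^ r := by
  simp_rw [japaneseBracket_rpow]
  exact Continuous.rpow_const (by fun_prop) fun x => Or.inl (by positivity)

theorem memLp_japaneseBracket_mul_schwartz {n : ℕ} (r : ℝ) (ψ : 𝓢(RSpace n, ℂ)) :
    MemLp (fun x => ((japaneseBracket x ^ r : ℝ) : ℂ) * ψ x) 2 volume := by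
  have hg := Function.hasTemperateGrowth_one_add_norm_sq_rpow (RSpace n) (r / 2)
  refine (memLp_congr_ae (Filter.Eventually.of_forall fun x => ?_)).1
    ((SchwartzMap.smulLeftCLM ℂ (fun x : RSpace n => (1 + ‖x‖ ^ 2) ^ (r / 2)) ψ).memLp 2 volume)
  rw [SchwartzMap.smulLeftCLM_apply_apply hg, japaneseBracket_rpow, Complex.real_smul]

theorem exists_eLpNorm_smoothedEvolution_le {m : ℕ} (a : MvPolynomial (Fin (m + 1)) ℝ) {s : ℝ}
    (hs : 1 / 2 < s) : ∃ C : NNReal, 0 < C ∧ ∀ g : RSpace (m + 1) → ℂ, Measurable g →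
      (Integrable fun ξ => ‖polyGradient a ((2 * Real.pi) • ξ)‖ ^ (1 / 2 : ℝ) * ‖g ξ‖) →
      eLpNorm (fun q : ℝ × RSpace (m + 1) =>
          ((japaneseBracket q.2 ^ (-s) : ℝ) : ℂ) * smoothedEvolution a g q) 2 volume
        ≤ C * eLpNorm g 2 volume := by
  obtain ⟨C, hC, h⟩ := exists_lintegral_smoothedEvolution_le a hs
  -- The square root undoes the squaring of the norms; the added 1 only makes the constant positive.
  refine ⟨NNReal.sqrt C.toNNReal + 1, by positivity, fun g hg hint => ?_⟩
  rw [← ENNReal.pow_le_pow_left_iff two_ne_zero, mul_pow, eLpNorm_two_sq, eLpNorm_two_sq]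
  have hC2 : C ≤ ((NNReal.sqrt C.toNNReal + 1 : NNReal) : ℝ≥0∞) ^ 2 := by
    conv_lhs => rw [← ENNReal.coe_toNNReal hC, ← NNReal.sq_sqrt C.toNNReal]
    rw [← ENNReal.coe_pow, ENNReal.coe_le_coe]
    gcongr
    exact le_self_add
  calc _ = ∫⁻ q : ℝ × RSpace (m + 1), ENNReal.ofReal ((1 + ‖q.2‖ ^ 2) ^ (-s))
        * ‖smoothedEvolution a g q‖ₑ ^ 2 := by
        refine lintegral_congr fun q => ?_
        have hb := Real.rpow_nonneg (japaneseBracket_pos q.2).le (-s)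
        rw [enorm_mul, mul_pow, ← ofReal_norm ((_ : ℝ) : ℂ), Complex.norm_real,
          Real.norm_of_nonneg hb, ← ENNReal.ofReal_pow hb, japaneseBracket_rpow,
          ← Real.rpow_mul_natCast (by positivity)]
        congr 3
        push_cast
        ring
    _ ≤ C * ∫⁻ ξ, ‖g ξ‖ₑ ^ 2 := h g hg hint
    _ ≤ _ := by gcongr

/-! ### Truncation in frequency and passage to the limit -/

section Truncation

variable {n : ℕ} (a : MvPolynomial (Fin n) ℝ) {g : RSpace n → ℂ}

/-- The restriction of `g` to the ball of radius `k`. -/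
noncomputable def ballTruncation (g : RSpace n → ℂ) (k : ℕ) : RSpace n → ℂ :=
  (Metric.closedBall 0 (k : ℝ)).indicator g

theorem measurable_ballTruncation (hg : Measurable g) (k : ℕ) : Measurable (ballTruncation g k) :=
  hg.indicator Metric.isClosed_closedBall.measurableSet

theorem memLp_ballTruncation (hg : MemLp g 2 volume) (k : ℕ) :
    MemLp (ballTruncation g k) 2 volume :=
  hg.indicator Metric.isClosed_closedBall.measurableSet

/-- On a ball L² embeds into L¹ and the continuous function |∇a|^{1/2} is bounded. -/
theorem integrable_sqrt_norm_polyGradient_mul_ballTruncation (hg : MemLp g 2 volume) (k : ℕ) :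
    Integrable fun ξ => ‖polyGradient a ((2 * Real.pi) • ξ)‖ ^ (1 / 2 : ℝ)
      * ‖ballTruncation g k ξ‖ := by
  set K := Metric.closedBall (0 : RSpace n) (k : ℝ) with hK
  have hKc : IsCompact K := isCompact_closedBall _ _
  have : IsFiniteMeasure (volume.restrict K) := ⟨by
    rw [Measure.restrict_apply_univ]; exact hKc.measure_lt_top⟩
  have h1 : IntegrableOn (fun ξ => ‖g ξ‖) K :=
    ((hg.restrict K).integrable one_le_two).norm
  have hc : Continuous fun ξ : RSpace n =>
      ‖polyGradient a ((2 * Real.pi) • ξ)‖ ^ (1 / 2 : ℝ) :=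
    (continuous_sqrt_norm_polyGradient a).comp (by fun_prop)
  have h2 := h1.continuousOn_mul hc.continuousOn hKc
  refine (h2.integrable_indicator hKc.measurableSet).congr
    (Filter.Eventually.of_forall fun ξ => ?_)
  by_cases hξ : ξ ∈ K <;> simp [ballTruncation, ← hK, hξ]

theorem tendsto_eLpNorm_ballTruncation_sub (hg : Measurable g) (hg2 : MemLp g 2 volume) :
    Filter.Tendsto (fun k => eLpNorm (ballTruncation g k - g) 2 volume) Filter.atTop (nhds 0) := by
  rw [tendsto_eLpNorm_two_iff]
  have hfin : ∫⁻ ξ, ‖g ξ‖ₑ ^ 2 ≠ ∞ := by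
    rw [← eLpNorm_two_sq]
    exact ENNReal.pow_ne_top hg2.2.ne
  have := tendsto_lintegral_of_dominated_convergence (μ := volume)
    (F := fun k ξ => ‖(ballTruncation g k - g) ξ‖ₑ ^ 2) (f := fun _ => 0) (fun ξ => ‖g ξ‖ₑ ^ 2)
    (fun k => ((measurable_ballTruncation hg k).sub hg).enorm.pow_const 2)
    (fun k => Filter.Eventually.of_forall fun ξ => ?_) hfin
    (Filter.Eventually.of_forall fun ξ => ?_)
  · simpa using this
  · by_cases hξ : ξ ∈ Metric.closedBall (0 : RSpace n) (k : ℝ) <;>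
      simp [ballTruncation, hξ, -Metric.mem_closedBall]
  · obtain ⟨N, hN⟩ := exists_nat_ge ‖ξ‖
    refine tendsto_const_nhds.congr' ?_
    filter_upwards [Filter.eventually_ge_atTop N] with k hk
    have hξ : ξ ∈ Metric.closedBall (0 : RSpace n) (k : ℝ) := by
      rw [mem_closedBall_zero_iff]
      exact hN.trans (Nat.cast_le.2 hk)
    simp [ballTruncation, hξ, -Metric.mem_closedBall]

end Truncation

section Evolution

variable {n : ℕ} (a : MvPolynomial (Fin n) ℝ)

theorem integrable_smoothingSymbol_mul {g : RSpace n → ℂ} (hg : Measurable g)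
    (hint : Integrable fun ξ => ‖polyGradient a ((2 * Real.pi) • ξ)‖ ^ (1 / 2 : ℝ) * ‖g ξ‖)
    (t : ℝ) : Integrable fun ξ =>
      smoothingSymbol (polySymbol a) t ((2 * Real.pi) • ξ) * g ξ := by
  refine hint.mono' (((continuous_smoothingSymbol a t).comp
    (by fun_prop)).measurable.mul hg).aestronglyMeasurable
    (Filter.Eventually.of_forall fun ξ => ?_)
  rw [norm_mul, norm_smoothingSymbol]

theorem smoothedEvolution_sub {g₁ g₂ : RSpace n → ℂ} (hg₁ : Measurable g₁) (hg₂ : Measurable g₂)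
    (h₁ : Integrable fun ξ => ‖polyGradient a ((2 * Real.pi) • ξ)‖ ^ (1 / 2 : ℝ) * ‖g₁ ξ‖)
    (h₂ : Integrable fun ξ => ‖polyGradient a ((2 * Real.pi) • ξ)‖ ^ (1 / 2 : ℝ) * ‖g₂ ξ‖)
    (q : ℝ × RSpace n) :
    smoothedEvolution a (g₁ - g₂) q = smoothedEvolution a g₁ q - smoothedEvolution a g₂ q := by
  have i₁ := integrable_smoothingSymbol_mul a hg₁ h₁ q.1
  have i₂ := integrable_smoothingSymbol_mul a hg₂ h₂ q.1
  have hexp : AEStronglyMeasurable (fun v : RSpace n =>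
      Complex.exp ((2 * Real.pi * inner ℝ v q.2 : ℝ) * Complex.I)) volume :=
    (by fun_prop : Continuous fun v : RSpace n =>
      Complex.exp ((2 * Real.pi * inner ℝ v q.2 : ℝ) * Complex.I)).aestronglyMeasurable
  have hb : ∀ᵐ v : RSpace n,
      ‖Complex.exp ((2 * Real.pi * inner ℝ v q.2 : ℝ) * Complex.I)‖ ≤ 1 :=
    Filter.Eventually.of_forall fun v => by rw [Complex.norm_exp_ofReal_mul_I]
  simp only [smoothedEvolution, Real.fourierInv_eq', smul_eq_mul]
  rw [← integral_sub (i₁.bdd_mul hexp hb) (i₂.bdd_mul hexp hb)]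
  refine integral_congr_ae (Filter.Eventually.of_forall fun v => ?_)
  simp only [Pi.sub_apply]
  ring

/-- For each g k the multiplier identity is Fubini. Both sides pass to the limit by Cauchy-Schwarz,
once the growing weight is moved onto ψ and the symbol onto 𝓕⁻ψ; the symbol times 𝓕φ itself need not
be in L². -/
theorem isFourierMultiplier_of_tendsto (t r : ℝ) (φ : Lp ℂ 2 (volume : Measure (RSpace n)))
    {g : ℕ → RSpace n → ℂ} (hgm : ∀ k, Measurable (g k))
    (hint : ∀ k, Integrable fun ξ =>
      ‖polyGradient a ((2 * Real.pi) • ξ)‖ ^ (1 / 2 : ℝ) * ‖g k ξ‖)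
    (hg : Filter.Tendsto (fun k => eLpNorm (fun ξ => g k ξ - (𝓕 φ) ξ) 2 volume)
      Filter.atTop (nhds 0))
    {V : RSpace n → ℂ} (hV : MemLp V 2 volume)
    (hlim : Filter.Tendsto (fun k => eLpNorm (fun x =>
      ((japaneseBracket x ^ (-r) : ℝ) : ℂ) * smoothedEvolution a (g k) (t, x) - V x) 2 volume)
      Filter.atTop (nhds 0)) :
    IsFourierMultiplier (smoothingSymbol (polySymbol a) t) φ
      (fun x => ((japaneseBracket x ^ r : ℝ) : ℂ) * V x) := by
  intro ψ
  have hψ := memLp_japaneseBracket_mul_schwartz r ψ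
  have hσ := memLp_smoothingSymbol_mul_schwartz a t (𝓕⁻ ψ)
  have hφ := Lp.memLp (𝓕 φ)
  have hVψ : ∀ x, ((japaneseBracket x ^ r : ℝ) : ℂ) * V x * ψ x
      = V x * (((japaneseBracket x ^ r : ℝ) : ℂ) * ψ x) := fun x => by ring
  have hφψ : ∀ ξ, smoothingSymbol (polySymbol a) t ((2 * Real.pi) • ξ) * (𝓕 φ) ξ * (𝓕⁻ ψ) ξ
      = (𝓕 φ) ξ * (smoothingSymbol (polySymbol a) t ((2 * Real.pi) • ξ) * (𝓕⁻ ψ) ξ) :=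
    fun ξ => by ring
  simp_rw [hVψ, hφψ]
  refine ⟨hV.integrable_mul hψ, hφ.integrable_mul hσ, ?_⟩
  have hm : ∀ k, AEStronglyMeasurable (fun x => ((japaneseBracket x ^ (-r) : ℝ) : ℂ)
      * smoothedEvolution a (g k) (t, x)) volume := fun k =>
    ((Complex.continuous_ofReal.comp (continuous_japaneseBracket_rpow (-r))).measurable.mul
      ((measurable_smoothedEvolution a (hgm k)).comp measurable_prodMk_left)).aestronglyMeasurable
  have l₁ := tendsto_integral_mul_of_eLpNorm_two hm hV hψ hlim
  have l₂ := tendsto_integral_mul_of_eLpNorm_two (fun k => (hgm k).aestronglyMeasurable) hφ hσ hg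
  refine tendsto_nhds_unique l₁ (l₂.congr fun k => ?_)
  have hflip := integral_fourierInv_mul_eq_of_integrable
    (integrable_smoothingSymbol_mul a (hgm k) (hint k) t) ψ.integrable
  calc _ = ∫ ξ, smoothingSymbol (polySymbol a) t ((2 * Real.pi) • ξ) * g k ξ
        * 𝓕⁻ (ψ : RSpace n → ℂ) ξ := by
        refine integral_congr_ae (Filter.Eventually.of_forall fun ξ => ?_)
        simp only [SchwartzMap.fourierInv_coe]
        ring
    _ = _ := by
        rw [← hflip]
        refine integral_congr_ae (Filter.Eventually.of_forall fun x => ?_)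
        have hone : ((japaneseBracket x ^ (-r) : ℝ) : ℂ) * ((japaneseBracket x ^ r : ℝ) : ℂ) = 1 := by
          rw [← Complex.ofReal_mul, ← Real.rpow_add (japaneseBracket_pos x), neg_add_cancel,
            Real.rpow_zero, Complex.ofReal_one]
        simp only [smoothedEvolution]
        linear_combination (-(𝓕⁻ (fun ξ =>
          smoothingSymbol (polySymbol a) t ((2 * Real.pi) • ξ) * g k ξ) x) * ψ x) * hone

end Evolution

/-! ### The estimate for general data -/

theorem theorem3p2 (n : ℕ) (hn : 1 ≤ n) (s : ℝ) (hs : 1 / 2 < s)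
    (a : MvPolynomial (Fin n) ℝ) :
    ∃ C : NNReal, 0 < C ∧
      ∀ φ : Lp ℂ 2 (volume : Measure (RSpace n)),
        ∃ v : ℝ × RSpace n → ℂ,
          IsSmoothedSolution (polySymbol a) φ v ∧
          eLpNorm (fun p : ℝ × RSpace n => ((japaneseBracket p.2 ^ (-s) : ℝ) : ℂ) * v p) 2
              (volume : Measure (ℝ × RSpace n))
            ≤ (C : ENNReal) * eLpNorm φ 2 (volume : Measure (RSpace n)) := by
  obtain ⟨m, rfl⟩ : ∃ m, n = m + 1 := ⟨n - 1, by omega⟩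
  obtain ⟨C, hC, hest⟩ := exists_eLpNorm_smoothedEvolution_le a hs
  refine ⟨C, hC, fun φ => ?_⟩
  set g : RSpace (m + 1) → ℂ :=
    ⇑(𝓕 φ : Lp ℂ 2 (volume : Measure (RSpace (m + 1)))) with hg
  have hgm : Measurable g := (Lp.stronglyMeasurable (𝓕 φ)).measurable
  have hg2 : MemLp g 2 volume := Lp.memLp (𝓕 φ)
  set G : ℕ → RSpace (m + 1) → ℂ := ballTruncation g with hG
  have hGm : ∀ k, Measurable (G k) := measurable_ballTruncation hgm
  have hG2 : ∀ k, MemLp (G k) 2 volume := memLp_ballTruncation hg2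
  have hGint := integrable_sqrt_norm_polyGradient_mul_ballTruncation a hg2
  have hGlim := tendsto_eLpNorm_ballTruncation_sub hgm hg2
  have hbm : ∀ r : ℝ, Measurable fun q : ℝ × RSpace (m + 1) =>
      ((japaneseBracket q.2 ^ r : ℝ) : ℂ) := fun r =>
    ((Complex.continuous_ofReal.comp (continuous_japaneseBracket_rpow r)).comp
      continuous_snd).measurable
  set U : ℕ → ℝ × RSpace (m + 1) → ℂ := fun k q =>
    ((japaneseBracket q.2 ^ (-s) : ℝ) : ℂ) * smoothedEvolution a (G k) q with hU
  have hUm : ∀ k, Measurable (U k) := fun k =>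
    (hbm (-s)).mul (measurable_smoothedEvolution a (hGm k))
  have hUle : ∀ k, eLpNorm (U k) 2 volume ≤ C * eLpNorm (G k) 2 volume := fun k =>
    hest (G k) (hGm k) (hGint k)
  have hU2 : ∀ k, MemLp (U k) 2 volume := fun k =>
    ⟨(hUm k).aestronglyMeasurable, (hUle k).trans_lt
      (ENNReal.mul_lt_top ENNReal.coe_lt_top (hG2 k).2)⟩
  -- Linearity lets the estimate be applied to differences, so convergence of the truncations makes
  -- the weighted evolutions Cauchy.
  have hUsub : ∀ k l, eLpNorm (U k - U l) 2 volume ≤ C * eLpNorm (G k - G l) 2 volume := by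
    intro k l
    refine le_trans (le_of_eq ?_) (hest (G k - G l) ((hGm k).sub (hGm l)) ?_)
    · congr 1
      ext q
      rw [smoothedEvolution_sub a (hGm k) (hGm l) (hGint k) (hGint l), mul_sub]
      rfl
    · refine ((hGint k).add (hGint l)).mono' ?_ (Filter.Eventually.of_forall fun ξ => ?_)
      · exact (((continuous_sqrt_norm_polyGradient a).comp
          (by fun_prop)).measurable.mul ((hGm k).sub (hGm l)).norm).aestronglyMeasurable
      · rw [Real.norm_of_nonneg (by positivity), Pi.add_apply, ← mul_add]
        gcongr
        exact norm_sub_le _ _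
  set G' : ℕ → Lp ℂ 2 (volume : Measure (RSpace (m + 1))) := fun k => (hG2 k).toLp (G k) with hG'
  set U' : ℕ → Lp ℂ 2 (volume : Measure (ℝ × RSpace (m + 1))) :=
    fun k => (hU2 k).toLp (U k) with hU'
  have hG'lim : Filter.Tendsto G' Filter.atTop (nhds (hg2.toLp g)) :=
    (Lp.tendsto_Lp_iff_tendsto_eLpNorm'' G hG2 g hg2).2 hGlim
  have hdist : ∀ k l, dist (U' k) (U' l) ≤ C * dist (G' k) (G' l) := by
    intro k l
    rw [Lp.dist_def, Lp.dist_def, ← ENNReal.coe_toReal C, ← ENNReal.toReal_mul]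
    refine ENNReal.toReal_mono (ENNReal.mul_ne_top ENNReal.coe_ne_top ?_) ?_
    · exact ((Lp.memLp (G' k)).sub (Lp.memLp (G' l))).2.ne
    · rw [eLpNorm_congr_ae ((hU2 k).coeFn_toLp.sub (hU2 l).coeFn_toLp),
        eLpNorm_congr_ae ((hG2 k).coeFn_toLp.sub (hG2 l).coeFn_toLp)]
      exact hUsub k l
  have hcauchy : CauchySeq U' := by
    rw [cauchySeq_iff_tendsto_dist_atTop_0]
    have h0 := (cauchySeq_iff_tendsto_dist_atTop_0.1 hG'lim.cauchySeq).const_mul (C : ℝ)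
    rw [mul_zero] at h0
    exact squeeze_zero (fun _ => dist_nonneg) (fun p => hdist p.1 p.2) h0
  obtain ⟨V, hV⟩ := cauchySeq_tendsto_of_complete hcauchy
  have hVm : StronglyMeasurable V := Lp.stronglyMeasurable V
  have hV2 : MemLp V 2 volume := Lp.memLp V
  have hUV : Filter.Tendsto (fun k => eLpNorm (U k - ⇑V) 2 volume) Filter.atTop (nhds 0) := by
    refine (Lp.tendsto_Lp_iff_tendsto_eLpNorm'' U hU2 V hV2).1 ?_
    rwa [Lp.toLp_coeFn]
  have hVnorm : ‖V‖ ≤ C * ‖φ‖ := by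
    have hnorm : ∀ k, ‖U' k‖ ≤ C * ‖G' k‖ := by
      intro k
      rw [Lp.norm_toLp, Lp.norm_toLp, ← ENNReal.coe_toReal C, ← ENNReal.toReal_mul]
      exact ENNReal.toReal_mono (ENNReal.mul_ne_top ENNReal.coe_ne_top (hG2 k).2.ne) (hUle k)
    have := le_of_tendsto_of_tendsto' hV.norm (hG'lim.norm.const_mul (C : ℝ)) hnorm
    -- Plancherel returns from the norm of the transform to that of φ.
    have hgφ : hg2.toLp g = 𝓕 φ := Lp.toLp_coeFn _ _
    rwa [hgφ, Lp.norm_fourier_eq] at this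
  -- V is the limit of the weighted evolutions, so the solution is recovered by undoing the weight.
  refine ⟨fun q => ((japaneseBracket q.2 ^ s : ℝ) : ℂ) * V q, ⟨?_, ?_⟩, ?_⟩
  · exact ((hbm s).mul hVm.measurable).aestronglyMeasurable
  · have hslice : Measurable fun q : ℝ × RSpace (m + 1) => ‖V q‖ₑ ^ 2 :=
      hVm.measurable.enorm.pow_const 2
    have hHm : ∀ k, Measurable fun q : ℝ × RSpace (m + 1) => ‖U k q - V q‖ₑ ^ 2 := fun k =>
      ((hUm k).sub hVm.measurable).enorm.pow_const 2
    have hUV2 := (tendsto_eLpNorm_two_iff _).1 hUV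
    have hfin : ∫⁻ q, ‖V q‖ₑ ^ 2 ≠ ∞ := by
      rw [← eLpNorm_two_sq]
      exact ENNReal.pow_ne_top hV2.2.ne
    simp only [Pi.sub_apply] at hUV2
    have hfubini : ∀ f : ℝ × RSpace (m + 1) → ℝ≥0∞, Measurable f →
        ∫⁻ q, f q = ∫⁻ t, ∫⁻ x, f (t, x) := fun f hf => lintegral_prod _ hf.aemeasurable
    rw [hfubini _ hslice] at hfin
    simp_rw [fun k => hfubini _ (hHm k)] at hUV2
    -- By Tonelli the squared L²(x) distances of the slices tend to 0 in L¹(t); a single subsequence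
    -- then serves almost every t.
    obtain ⟨ns, hns, hae⟩ := exists_subseq_ae_tendsto_zero
      (fun k => (hHm k).lintegral_prod_right') hUV2
    filter_upwards [hae, ae_lt_top hslice.lintegral_prod_right' hfin] with t ht hVt
    refine isFourierMultiplier_of_tendsto a t s φ (g := fun k => G (ns k)) (fun k => hGm _)
      (fun k => hGint _) (hGlim.comp hns.tendsto_atTop) (V := fun x => V (t, x)) ?_ ?_
    · refine ⟨(hVm.measurable.comp measurable_prodMk_left).aestronglyMeasurable, ?_⟩
      rw [← eLpNorm_two_sq] at hVt
      exact lt_top_iff_ne_top.2 fun h => by simp [h] at hVt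
    · exact (tendsto_eLpNorm_two_iff _).2 ht
  · have hfun : (fun q : ℝ × RSpace (m + 1) => ((japaneseBracket q.2 ^ (-s) : ℝ) : ℂ)
        * (((japaneseBracket q.2 ^ s : ℝ) : ℂ) * V q)) = V := by
      ext q
      rw [← mul_assoc, ← Complex.ofReal_mul, ← Real.rpow_add (japaneseBracket_pos q.2),
        neg_add_cancel, Real.rpow_zero, Complex.ofReal_one, one_mul]
    rw [hfun, ← Lp.enorm_def, ← Lp.enorm_def, ← ofReal_norm, ← ofReal_norm,
      ← ENNReal.ofReal_coe_nnreal, ← ENNReal.ofReal_mul C.coe_nonneg]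
    exact ENNReal.ofReal_le_ofReal hVnorm
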